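/- Let $n\in\mathbb N$, $p\in(\tfrac73,\tfrac83)$ and $s:=\tfrac32p-3\in(\tfrac12,1)$. For a $1$-periodic function $f\in L^2(\mathbb R/\mathbb Z,\mathbb R^n)$ put $$[f]_{s,2}:=\Big(\int_{\mathbb R/\mathbb Z}\int_{-1/2}^{1/2}\frac{|f(u+w)-f(u)|^2}{|w|^{1+2s}}\,dw\,du\Big)^{1/2},$$ and let $W^{\frac32p-2,2}(\mathbb R/\mathbb Z,\mathbb R^n)=W^{1+s,2}(\mathbb R/\mathbb Z,\mathbb R^n)$ be the space of $1$-periodic functions $f\in L^2(\mathbb R/\mathbb Z,\mathbb R^n)$ with a weak derivative $f'\in L^2(\mathbb R/\mathbb Z,\mathbb R^n)$ such that $[f']_{s,2}<\infty$; its elements are identified with their continuous (in fact $C^1$) representatives. Let $W^{\frac32p-2,2}_{\mathrm{ir}}(\mathbb R/\mathbb Z,\mathbb R^n)$ be the set of those $\gamma$ in this space that are injective on $[0,1)$ and satisfy $|\gamma'|>0$ everywhere. For such $\gamma$ let $$\mathrm{BiLip}(\gamma):=\inf_{u_1\ne u_2\in\mathbb R/\mathbb Z}\frac{|\gamma(u_1)-\gamma(u_2)|}{|u_1-u_2|_{\mathbb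 R/\mathbb Z}},\qquad |w|_{\mathbb R/\mathbb Z}:=\min_{k\in\mathbb Z}|w+k|.$$ The generalized integral Menger curvature of $\gamma$ is $$\mathcal M^{(p,2)}(\gamma):=\iiint_{(\mathbb R/\mathbb Z)^3}\frac{|(\gamma(u_2)-\gamma(u_1))\wedge(\gamma(u_3)-\gamma(u_1))|^2}{\big(|\gamma(u_2)-\gamma(u_1)|\,|\gamma(u_3)-\gamma(u_1)|\,|\gamma(u_2)-\gamma(u_3)|\big)^p}\,|\gamma'(u_1)||\gamma'(u_2)||\gamma'(u_3)|\,du_1du_2du_3 ,$$ where $|a\wedge b|$ is the Euclidean norm of the exterior product. Its first and second variations are $$\delta\mathcal M^{(p,2)}(\gamma,h):=\tfrac{d}{d\tau}\Big|_{\tau=0}\mathcal M^{(p,2)}(\gamma+\tau h),\qquad \delta^2\mathcal M^{(p,2)}(\gamma)[h,g]:=\tfrac{d}{d\tau}\Big|_{\tau=0}\delta\mathcal M^{(p,2)}(\gamma+\tau g,h),$$ which are said to exist if the values (for all sufficiently small $|\tau|$) on the right-hand sides are finite, respectively exist, and the derivatives exist. Then there are functions $C_1,C_2:(0,\infty)\times[0,\infty)\to\mathbb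 R$, depending only on $n$ and $p$, each non-increasing in its first and non-decreasing in its second argument, such that for every $\gamma\in W^{\frac32p-2,2}_{\mathrm{ir}}(\mathbb R/\mathbb Z,\mathbb R^n)$ and all $h,g\in W^{\frac32p-2,2}(\mathbb R/\mathbb Z,\mathbb R^n)$ the first variation $\delta\mathcal M^{(p,2)}(\gamma,h)$ and the second variation $\delta^2\mathcal M^{(p,2)}(\gamma)[h,g]$ exist and satisfy $$|\delta\mathcal M^{(p,2)}(\gamma,h)|\le C_1\,[h']_{s,2},\qquad |\delta^2\mathcal M^{(p,2)}(\gamma)[h,g]|\le C_2\,[h']_{s,2}\,[g']_{s,2},$$ where $C_i=C_i\big(\mathrm{BiLip}(\gamma),[\gamma']_{s,2}\big)$ for $i=1,2$. -/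

import Mathlib

open MeasureTheory Filter Topology Set
open scoped ENNReal ContDiff

namespace Menger

/-- `g` is the weak derivative of `f` on the real line. -/
def HasWeakDeriv {E : Type*} [NormedAddCommGroup E] [NormedSpace ℝ E] (f g : ℝ → E) : Prop :=
  LocallyIntegrable f ∧ LocallyIntegrable g ∧
    ∀ φ : ℝ → ℝ, ContDiff ℝ ∞ φ → HasCompactSupport φ →
      ∫ x, deriv φ x • f x = -∫ x, φ x • g x

/-- The Sobolev-Slobodeckij seminorm `[f]_{s,2}` of a `1`-periodic function, with values
in `[0,∞]`. -/
noncomputable def slobodeckij {E : Type*} [NormedAddCommGroup E] (s : ℝ) (f : ℝ → E) : ℝ≥0∞ :=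
  (∫⁻ u in Ioc (0 : ℝ) 1, ∫⁻ w in Ioo (-(1 / 2) : ℝ) (1 / 2),
    ENNReal.ofReal (‖f (u + w) - f u‖ ^ 2 / |w| ^ (1 + 2 * s))) ^ (1 / 2 : ℝ)

/-- The seminorm `[f]_{s,2}` as a real number, to be used where it is finite. -/
noncomputable def slobodeckijReal {E : Type*} [NormedAddCommGroup E] (s : ℝ) (f : ℝ → E) : ℝ :=
  (slobodeckij s f).toReal

/-- `f` is (the continuous representative of) a function in the periodic Sobolev-Slobodeckij space
`W^{1+s,2}(ℝ/ℤ, E)`: it has a weak derivative `g` in `L²(ℝ/ℤ, E)` with `[g]_{s,2} < ∞`.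
For such `f` the weak derivative agrees almost everywhere with the classical `deriv f`. -/
def MemW {E : Type*} [NormedAddCommGroup E] [NormedSpace ℝ E] (s : ℝ) (f : ℝ → E) : Prop :=
  Function.Periodic f 1 ∧ Continuous f ∧
    ∃ g : ℝ → E, Function.Periodic g 1 ∧ HasWeakDeriv f g ∧
      MemLp g 2 (volume.restrict (Ioc (0 : ℝ) 1)) ∧ slobodeckij s g ≠ ⊤

/-- The injective regular curves in `W^{1+s,2}(ℝ/ℤ, E)`. -/
def MemWir {E : Type*} [NormedAddCommGroup E] [NormedSpace ℝ E] (s : ℝ) (γ : ℝ → E) : Prop :=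
  MemW s γ ∧ InjOn γ (Ico (0 : ℝ) 1) ∧ ∀ u, deriv γ u ≠ 0

/-- The bilipschitz constant of a `1`-periodic curve: the infimum of
`|γ(u₁) - γ(u₂)| / |u₁ - u₂|_{ℝ/ℤ}` over all `u₁ ≠ u₂` in `ℝ/ℤ`. -/
noncomputable def biLip {E : Type*} [NormedAddCommGroup E] (γ : ℝ → E) : ℝ :=
  sInf {r : ℝ | ∃ u₁ u₂ : ℝ, (u₁ : UnitAddCircle) ≠ (u₂ : UnitAddCircle) ∧
    r = ‖γ u₁ - γ u₂‖ / ‖((u₁ - u₂ : ℝ) : UnitAddCircle)‖}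

/-- The exterior product `a ∧ b`, given by its coordinates in the orthonormal basis
`e_i ∧ e_j`, `i < j`, of the second exterior power of `ℝⁿ`. -/
noncomputable def wedge {n : ℕ} (a b : EuclideanSpace ℝ (Fin n)) :
    EuclideanSpace ℝ {ij : Fin n × Fin n // ij.1 < ij.2} :=
  WithLp.toLp 2 fun ij => a ij.1.1 * b ij.1.2 - a ij.1.2 * b ij.1.1

/-- The inverse `1 / R^{(p,q)}(x,y,z)` of the generalized circumcircle diameter
`R^{(p,q)}(x,y,z) = (|y - x| |z - x| |y - z|)^p / |(y - x) ∧ (z - x)|^q`. -/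
noncomputable def invR {n : ℕ} (p q : ℝ) (x y z : EuclideanSpace ℝ (Fin n)) : ℝ :=
  ‖wedge (y - x) (z - x)‖ ^ q / (‖y - x‖ * ‖z - x‖ * ‖y - z‖) ^ p

/-- The generalized integral Menger curvature `M^{(p,q)}`, with values in `[0,∞]`. -/
noncomputable def menger {n : ℕ} (p q : ℝ) (γ : ℝ → EuclideanSpace ℝ (Fin n)) : ℝ≥0∞ :=
  ∫⁻ u : ℝ × ℝ × ℝ in Ioc (0 : ℝ) 1 ×ˢ Ioc (0 : ℝ) 1 ×ˢ Ioc (0 : ℝ) 1,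
    ENNReal.ofReal (‖deriv γ u.1‖ * ‖deriv γ u.2.1‖ * ‖deriv γ u.2.2‖ *
      invR p q (γ u.1) (γ u.2.1) (γ u.2.2))

/-- The first variation `δF(γ,h)`, the derivative of `τ ↦ F(γ + τ h)` at `τ = 0`, exists and
equals `d`. The functional has to be finite near `γ` along the line. -/
def HasFirstVariation {E : Type*} [NormedAddCommGroup E] [NormedSpace ℝ E]
    (F : (ℝ → E) → ℝ≥0∞) (γ h : ℝ → E) (d : ℝ) : Prop :=
  (∀ᶠ τ : ℝ in 𝓝 0, F (γ + τ • h) ≠ ⊤) ∧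
    HasDerivAt (fun τ : ℝ => (F (γ + τ • h)).toReal) d 0

/-- The second variation `δ²F(γ)[h,g]`, the derivative of `τ ↦ δF(γ + τ g, h)` at `τ = 0`,
exists and equals `d`. -/
def HasSecondVariation {E : Type*} [NormedAddCommGroup E] [NormedSpace ℝ E]
    (F : (ℝ → E) → ℝ≥0∞) (γ h g : ℝ → E) (d : ℝ) : Prop :=
  ∃ δF : ℝ → ℝ, (∀ᶠ τ : ℝ in 𝓝 0, HasFirstVariation F (γ + τ • g) h (δF τ)) ∧
    HasDerivAt δF d 0

/-- A constant `C(b,a)` that is non-increasing in `b > 0` and non-decreasing in `a ≥ 0`. -/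
def IsMonotoneConstant (C : ℝ → ℝ → ℝ) : Prop :=
  (∀ a, 0 ≤ a → AntitoneOn (fun b => C b a) (Ioi 0)) ∧
    ∀ b, 0 < b → MonotoneOn (fun a => C b a) (Ici 0)

end Menger

/-! Write a triple as `(u, u + v, u + w)`. Every chord is its parameter step times an average of
`γ'`, and since `a ∧ b = a ∧ (b - a)`, the wedge of the two chords at `u` is `v w` times `avg γ u v
∧ (avg γ u w - avg γ u v)`. Hence the integrand is a kernel in `(v, w)` times a quadratic form
`B(y)(e, e)`, where `e` is the difference of the two averages (`defect`) and `B` is smooth in the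
averages and derivatives `y` (`jet`) as long as none of them vanishes. The kernel does not involve
the curve, and `y` and `e` are linear in it. So `M(γ + τh) = ∫ B(y + τη)(e + τε, e + τε)` over a
fixed measure, and both variations come from differentiating under the integral sign, with `y` in a
compact set, `η` bounded and `e`, `ε` in `L²`.

Three estimates supply this.

(1) `lintegral_defect_sq_le`: the weighted `L²` norm of the defect of `f` is at most a constant
times `[f']`. The factor `|v - w|^(-p)` of the kernel is tamed by symmetry: it suffices to integrate
over triples whose first point is opposite to the longest side (`lintegral₃_eq_multiplicity`). There
the kernel is at most `|v|^(2-p) |w|^(2-p) max(|v|, |w|)^(-p)`, and integrating out one variable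
leaves the Slobodeckij weight `|v|^(-(1+2s))`.

(2) `MemW.contDiff_and_bound`: since `s > 1/2`, elements of the space are `C¹`, and `sup |f'|` is at
most a constant times `[f']` alone, because `f` is periodic. This is why no lower-order norm of `h`,
`g` appears.

(3) `jet_mem_annulus`: all entries of `y` have norm between `BiLip(γ)` and `sup |γ'|`. The supremum
of `B`, `DB`, `D²B` over this annulus is the source of the constants, and the annulus grows as
`BiLip` decreases or the seminorm increases. -/

namespace Menger

/-! ### Continuous functions are primitives of their weak derivatives. -/

section Transition

/-- The derivative of the smooth transition function vanishes outside `[0, 1]`. -/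
theorem deriv_smoothTransition_eq_zero {t : ℝ} (ht : t ∉ Icc (0 : ℝ) 1) :
    deriv Real.smoothTransition t = 0 := by
  rw [mem_Icc, not_and_or, not_le, not_le] at ht
  rcases ht with ht | ht
  · have : Real.smoothTransition =ᶠ[𝓝 t] fun _ => 0 := by
      filter_upwards [Iio_mem_nhds ht] with x hx
      exact Real.smoothTransition.zero_of_nonpos hx.le
    rw [this.deriv_eq, deriv_const]
  · have : Real.smoothTransition =ᶠ[𝓝 t] fun _ => 1 := by
      filter_upwards [Ioi_mem_nhds ht] with x hx
      exact Real.smoothTransition.one_of_one_le (le_of_lt hx)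
    rw [this.deriv_eq, deriv_const]

theorem differentiable_smoothTransition : Differentiable ℝ Real.smoothTransition :=
  (Real.smoothTransition.contDiff (n := 1)).differentiable (by norm_num)

theorem continuous_deriv_smoothTransition : Continuous (deriv Real.smoothTransition) :=
  (Real.smoothTransition.contDiff (n := 1)).continuous_deriv (by norm_num)

theorem hasCompactSupport_deriv_smoothTransition :
    HasCompactSupport (deriv Real.smoothTransition) :=
  HasCompactSupport.intro isCompact_Icc fun _ hx => deriv_smoothTransition_eq_zero hx

theorem integral_deriv_smoothTransition : ∫ t, deriv Real.smoothTransition t = 1 := by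
  have h1 : ∫ t, deriv Real.smoothTransition t =
      ∫ t in Icc (0 : ℝ) 1, deriv Real.smoothTransition t := by
    rw [setIntegral_eq_integral_of_forall_compl_eq_zero]
    exact fun x hx => deriv_smoothTransition_eq_zero hx
  rw [h1, integral_Icc_eq_integral_Ioc, ← intervalIntegral.integral_of_le zero_le_one,
    intervalIntegral.integral_deriv_eq_sub (fun x _ => differentiable_smoothTransition x)
      (continuous_deriv_smoothTransition.intervalIntegrable _ _)]
  simp

variable {E : Type*} [NormedAddCommGroup E] [NormedSpace ℝ E] [CompleteSpace E]

/-- The weights form an approximate identity supported in `[a, a + 1/(k+1)]`; the substitution `t =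
(k+1)(y - a)` fixes the weight and moves the dependence on `k` into the argument of `f`. -/
theorem tendsto_integral_deriv_smoothTransition {f : ℝ → E} (hf : Continuous f) (a : ℝ) :
    Tendsto (fun k : ℕ => ∫ y, (((k : ℝ) + 1) *
      deriv Real.smoothTransition (((k : ℝ) + 1) * (y - a))) • f y) atTop (𝓝 (f a)) := by
  have key : ∀ k : ℕ, ∫ y, (((k : ℝ) + 1) *
      deriv Real.smoothTransition (((k : ℝ) + 1) * (y - a))) • f y =
      ∫ t, deriv Real.smoothTransition t • f (a + t / ((k : ℝ) + 1)) := by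
    intro k
    have hc : (0 : ℝ) < (k : ℝ) + 1 := by positivity
    set c : ℝ := (k : ℝ) + 1
    set Ψ : ℝ → E := fun t => deriv Real.smoothTransition t • f (a + t / c)
    have h1 : ∀ y, (c * deriv Real.smoothTransition (c * (y - a))) • f y =
        c • Ψ (c * (y - a)) := by
      intro y
      simp only [Ψ]
      rw [mul_smul, mul_div_cancel_left₀ _ hc.ne', add_sub_cancel]
    simp_rw [h1]
    rw [integral_smul, integral_sub_right_eq_self (fun y => Ψ (c * y)),
      Measure.integral_comp_mul_left, abs_of_pos (inv_pos.2 hc), smul_smul,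
      mul_inv_cancel₀ hc.ne', one_smul]
  simp_rw [key]
  have hlim : f a = ∫ t, deriv Real.smoothTransition t • f a := by
    rw [integral_smul_const, integral_deriv_smoothTransition, one_smul]
  rw [hlim]
  obtain ⟨C, hC⟩ := (isCompact_Icc (a := a) (b := a + 1)).exists_bound_of_continuousOn
    hf.continuousOn
  refine tendsto_integral_of_dominated_convergence
    (fun t => ‖deriv Real.smoothTransition t‖ * C) ?_ ?_ ?_ ?_
  · intro k
    exact (continuous_deriv_smoothTransition.smul
      (hf.comp (by fun_prop))).aestronglyMeasurable
  · exact ((continuous_deriv_smoothTransition.integrable_of_hasCompactSupport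
      hasCompactSupport_deriv_smoothTransition).norm.mul_const C)
  · intro k
    refine Eventually.of_forall fun t => ?_
    by_cases ht : t ∈ Icc (0 : ℝ) 1
    · rw [norm_smul]
      refine mul_le_mul_of_nonneg_left (hC _ ?_) (norm_nonneg _)
      have hc : (1 : ℝ) ≤ (k : ℝ) + 1 := by linarith [(Nat.cast_nonneg k : (0 : ℝ) ≤ k)]
      constructor
      · have : 0 ≤ t / ((k : ℝ) + 1) := div_nonneg ht.1 (by linarith)
        linarith
      · have : t / ((k : ℝ) + 1) ≤ 1 := by
          rw [div_le_one (by linarith)]; linarith [ht.2]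
        linarith
    · rw [deriv_smoothTransition_eq_zero ht]; simp
  · refine Eventually.of_forall fun t => ?_
    refine Tendsto.const_smul ?_ _
    have h2 : Tendsto (fun k : ℕ => a + t / ((k : ℝ) + 1)) atTop (𝓝 a) := by
      have := tendsto_one_div_add_atTop_nhds_zero_nat (𝕜 := ℝ)
      have := (this.const_mul t).const_add a
      simpa [div_eq_mul_inv] using this
    exact (hf.tendsto a).comp h2

/-- A continuous function is the primitive of its weak derivative. -/
theorem HasWeakDeriv.sub_eq_integral {f g : ℝ → E} (h : HasWeakDeriv f g) (hf : Continuous f)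
    {a b : ℝ} (hab : a ≤ b) : f b - f a = ∫ x in a..b, g x := by
  obtain ⟨-, hg, hφ⟩ := h
  -- Test functions that rise just to the right of `a` and fall just to the right of `b`: they
  -- converge pointwise to the indicator of `(a, b]`, while their derivatives are the difference of
  -- approximate identities at `a` and at `b`.
  set φ : ℕ → ℝ → ℝ := fun k y => Real.smoothTransition (((k : ℝ) + 1) * (y - a)) -
    Real.smoothTransition (((k : ℝ) + 1) * (y - b)) with hφdef
  have hpos : ∀ k : ℕ, (0 : ℝ) < (k : ℝ) + 1 := fun k => by positivity
  have hone : ∀ k : ℕ, (1 : ℝ) ≤ (k : ℝ) + 1 := fun k => by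
    linarith [(Nat.cast_nonneg k : (0 : ℝ) ≤ k)]
  have hsm : ∀ k, ContDiff ℝ ∞ (φ k) := fun k => by
    refine ContDiff.sub ?_ ?_ <;>
    exact (Real.smoothTransition.contDiff (n := ⊤)).comp (by fun_prop)
  have hsupp : ∀ k, ∀ y ∉ Icc a (b + 1), φ k y = 0 := by
    intro k y hy
    rw [mem_Icc, not_and_or, not_le, not_le] at hy
    simp only [φ]
    rcases hy with hy | hy
    · rw [Real.smoothTransition.zero_of_nonpos, Real.smoothTransition.zero_of_nonpos, sub_zero]
      · exact mul_nonpos_of_nonneg_of_nonpos (hpos k).le (by linarith)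
      · exact mul_nonpos_of_nonneg_of_nonpos (hpos k).le (by linarith)
    · rw [Real.smoothTransition.one_of_one_le, Real.smoothTransition.one_of_one_le, sub_self]
      · nlinarith [hone k]
      · nlinarith [hone k]
  have hcs : ∀ k, HasCompactSupport (φ k) := fun k =>
    HasCompactSupport.intro isCompact_Icc (hsupp k)
  have hder : ∀ k y, deriv (φ k) y =
      ((k : ℝ) + 1) * deriv Real.smoothTransition (((k : ℝ) + 1) * (y - a)) -
      ((k : ℝ) + 1) * deriv Real.smoothTransition (((k : ℝ) + 1) * (y - b)) := by
    intro k y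
    have : ∀ c : ℝ, HasDerivAt (fun y => Real.smoothTransition (((k : ℝ) + 1) * (y - c)))
        (((k : ℝ) + 1) * deriv Real.smoothTransition (((k : ℝ) + 1) * (y - c))) y := by
      intro c
      have h1 : HasDerivAt (fun y : ℝ => ((k : ℝ) + 1) * (y - c)) ((k : ℝ) + 1) y := by
        simpa using ((hasDerivAt_id y).sub_const c).const_mul ((k : ℝ) + 1)
      have := (differentiable_smoothTransition
        (((k : ℝ) + 1) * (y - c))).hasDerivAt.comp y h1
      simpa [mul_comm, Function.comp_def] using this
    exact ((this a).sub (this b)).deriv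
  have hint : ∀ (k : ℕ) (c : ℝ), Integrable (fun y => (((k : ℝ) + 1) *
      deriv Real.smoothTransition (((k : ℝ) + 1) * (y - c))) • f y) := by
    intro k c
    refine Continuous.integrable_of_hasCompactSupport ?_ ?_
    · exact (continuous_const.mul (continuous_deriv_smoothTransition.comp
        (by fun_prop))).smul hf
    · refine HasCompactSupport.intro (isCompact_Icc (a := c) (b := c + 1)) fun y hy => ?_
      rw [deriv_smoothTransition_eq_zero, mul_zero, zero_smul]
      intro hy'
      refine hy ⟨?_, ?_⟩
      · by_contra hlt
        push Not at hlt
        nlinarith [hy'.1, hpos k]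
      · by_contra hlt
        push Not at hlt
        nlinarith [hy'.2, hone k]
  have hL : Tendsto (fun k => ∫ x, deriv (φ k) x • f x) atTop (𝓝 (f a - f b)) := by
    have := (tendsto_integral_deriv_smoothTransition hf a).sub
      (tendsto_integral_deriv_smoothTransition hf b)
    refine this.congr fun k => ?_
    rw [← integral_sub (hint k a) (hint k b)]
    refine integral_congr_ae (Eventually.of_forall fun y => ?_)
    simp only [hder, sub_smul]
  have hR : Tendsto (fun k => ∫ x, φ k x • g x) atTop (𝓝 (∫ x in a..b, g x)) := by
    rw [intervalIntegral.integral_of_le hab, ← integral_indicator measurableSet_Ioc]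
    refine tendsto_integral_of_dominated_convergence
      (fun x => ‖(Icc a (b + 1)).indicator g x‖) ?_ ?_ ?_ ?_
    · intro k
      exact (hsm k).continuous.aestronglyMeasurable.smul hg.aestronglyMeasurable
    · exact ((integrable_indicator_iff measurableSet_Icc).2
        (hg.integrableOn_isCompact isCompact_Icc)).norm
    · intro k
      refine Eventually.of_forall fun x => ?_
      by_cases hx : x ∈ Icc a (b + 1)
      · rw [indicator_of_mem hx, norm_smul]
        refine mul_le_of_le_one_left (norm_nonneg _) ?_
        rw [Real.norm_eq_abs, abs_le]
        simp only [φ]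
        constructor <;>
        linarith [Real.smoothTransition.le_one (((k : ℝ) + 1) * (x - a)),
          Real.smoothTransition.nonneg (((k : ℝ) + 1) * (x - a)),
          Real.smoothTransition.le_one (((k : ℝ) + 1) * (x - b)),
          Real.smoothTransition.nonneg (((k : ℝ) + 1) * (x - b))]
      · rw [hsupp k x hx]; simp
    · refine Eventually.of_forall fun x => ?_
      have hlim : ∀ c : ℝ, Tendsto (fun k : ℕ => Real.smoothTransition (((k : ℝ) + 1) * (x - c)))
          atTop (𝓝 (if c < x then 1 else 0)) := by
        intro c
        split_ifs with hcx
        · refine tendsto_const_nhds.congr' ?_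
          have : Tendsto (fun k : ℕ => ((k : ℝ) + 1) * (x - c)) atTop atTop :=
            Tendsto.atTop_mul_const (sub_pos.2 hcx)
              (tendsto_atTop_add_const_right _ _ tendsto_natCast_atTop_atTop)
          filter_upwards [this.eventually_ge_atTop 1] with k hk
          rw [Real.smoothTransition.one_of_one_le hk]
        · refine tendsto_const_nhds.congr fun k => ?_
          rw [Real.smoothTransition.zero_of_nonpos]
          exact mul_nonpos_of_nonneg_of_nonpos (hpos k).le (by linarith)
      have h3 := ((hlim a).sub (hlim b)).smul_const (g x)
      convert h3 using 2
      by_cases h1 : a < x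
      · by_cases h2 : b < x
        · simp [h1, h2, indicator_of_notMem, mem_Ioc]
        · simp [h1, h2, not_lt.1 h2, mem_Ioc]
      · have h2 : ¬ b < x := fun h => h1 (lt_of_le_of_lt hab h)
        simp [h1, h2, mem_Ioc]
  have heq : Tendsto (fun k => ∫ x, deriv (φ k) x • f x) atTop (𝓝 (-∫ x in a..b, g x)) :=
    hR.neg.congr fun k => (hφ (φ k) (hsm k) (hcs k)).symm
  have := tendsto_nhds_unique hL heq
  rw [← neg_sub, this, neg_neg]

end Transition

/-! ### Second differences are controlled by the Slobodeckij seminorm. -/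

section Morrey

/-- The Cauchy-Schwarz inequality against the constant function `1`. -/
theorem sq_lintegral_le {α : Type*} [MeasurableSpace α] {μ : Measure α} {φ : α → ℝ≥0∞}
    (hφ : AEMeasurable φ μ) : (∫⁻ x, φ x ∂μ) ^ 2 ≤ μ univ * ∫⁻ x, φ x ^ 2 ∂μ := by
  have h := ENNReal.lintegral_mul_le_Lp_mul_Lq μ (Real.HolderConjugate.two_two) hφ
    (aemeasurable_const (b := (1 : ℝ≥0∞)))
  simp only [Pi.mul_apply, mul_one, ENNReal.one_rpow, lintegral_const, one_mul] at h
  calc (∫⁻ x, φ x ∂μ) ^ 2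
      ≤ ((∫⁻ a, φ a ^ (2 : ℝ) ∂μ) ^ (1 / 2 : ℝ) * μ univ ^ (1 / 2 : ℝ)) ^ 2 := by gcongr
    _ = μ univ * ∫⁻ x, φ x ^ 2 ∂μ := by
      rw [mul_pow, ← ENNReal.rpow_natCast, ← ENNReal.rpow_mul, ← ENNReal.rpow_natCast,
        ← ENNReal.rpow_mul, mul_comm]
      norm_num

/-- The integral of a periodic function over a period does not depend on the period. -/
theorem lintegral_Ioc_periodic {H : ℝ → ℝ≥0∞} (hH : Function.Periodic H 1) (a b : ℝ) :
    ∫⁻ u in Ioc a (a + 1), H u = ∫⁻ u in Ioc b (b + 1), H u := by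
  refine (isAddFundamentalDomain_Ioc zero_lt_one a).setLIntegral_eq
    (isAddFundamentalDomain_Ioc zero_lt_one b) H ?_
  rintro ⟨g, hg⟩ x
  obtain ⟨k, rfl⟩ := AddSubgroup.mem_zmultiples_iff.1 hg
  have := hH.zsmul k x
  simpa [AddSubgroup.vadd_def, add_comm] using this

variable {E : Type*} [NormedAddCommGroup E]

theorem slobodeckij_sq (s : ℝ) (f : ℝ → E) : slobodeckij s f ^ 2 =
    ∫⁻ u in Ioc (0 : ℝ) 1, ∫⁻ w in Ioo (-(1 / 2) : ℝ) (1 / 2),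
      ENNReal.ofReal (‖f (u + w) - f u‖ ^ 2 / |w| ^ (1 + 2 * s)) := by
  rw [slobodeckij, ← ENNReal.rpow_natCast, ← ENNReal.rpow_mul]
  norm_num

/-- Points of the two adjacent intervals satisfy `0 < z - y < 2l`, so inserting the weight `(2l / |z
- y|)^(1+2s) ≥ 1` only increases the integral; `l ≤ 1/4` keeps the increment inside the range of the
seminorm. -/
theorem lintegral_lintegral_le_slobodeckij {s : ℝ} (hs : 0 ≤ 1 + 2 * s) {g : ℝ → E}
    (hper : Function.Periodic g 1) {x l : ℝ} (hl4 : l ≤ 1 / 4) :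
    ∫⁻ y in Ioc x (x + l), ∫⁻ z in Ioc (x + l) (x + 2 * l), ‖g z - g y‖ₑ ^ 2 ≤
      ENNReal.ofReal ((2 * l) ^ (1 + 2 * s)) * slobodeckij s g ^ 2 := by
  set H : ℝ → ℝ≥0∞ := fun u => ∫⁻ w in Ioo (-(1 / 2) : ℝ) (1 / 2),
      ENNReal.ofReal (‖g (u + w) - g u‖ ^ 2 / |w| ^ (1 + 2 * s)) with hH
  have hHper : Function.Periodic H 1 := by
    intro u
    simp only [hH]
    refine lintegral_congr fun w => ?_
    rw [hper u, show u + 1 + w = u + w + 1 by ring, hper]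
  have inner : ∀ y ∈ Ioc x (x + l), ∫⁻ z in Ioc (x + l) (x + 2 * l), ‖g z - g y‖ₑ ^ 2 ≤
      ENNReal.ofReal ((2 * l) ^ (1 + 2 * s)) * H y := by
    intro y hy
    rw [← lintegral_indicator measurableSet_Ioc, ← lintegral_add_left_eq_self _ y, hH,
      ← lintegral_const_mul' _ _ ENNReal.ofReal_ne_top,
      ← lintegral_indicator measurableSet_Ioo]
    refine lintegral_mono fun w => ?_
    by_cases hw : y + w ∈ Ioc (x + l) (x + 2 * l)
    · have hw0 : 0 < w := by linarith [hw.1, hy.2]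
      have hw1 : w < 2 * l := by linarith [hw.2, hy.1]
      have hw2 : w ∈ Ioo (-(1 / 2) : ℝ) (1 / 2) := ⟨by linarith, by linarith⟩
      rw [indicator_of_mem hw, indicator_of_mem hw2, ← ofReal_norm,
        ← ENNReal.ofReal_pow (norm_nonneg _), ← ENNReal.ofReal_mul
          (Real.rpow_nonneg (by linarith) _)]
      refine ENNReal.ofReal_le_ofReal ?_
      rw [abs_of_pos hw0, ← mul_div_assoc, le_div_iff₀ (Real.rpow_pos_of_pos hw0 _), mul_comm]
      exact mul_le_mul_of_nonneg_right (Real.rpow_le_rpow hw0.le hw1.le hs) (by positivity)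
    · rw [indicator_of_notMem hw]; exact zero_le
  calc _ ≤ ∫⁻ y in Ioc x (x + l), ENNReal.ofReal ((2 * l) ^ (1 + 2 * s)) * H y :=
        setLIntegral_mono' measurableSet_Ioc inner
    _ ≤ ∫⁻ y in Ioc x (x + 1), ENNReal.ofReal ((2 * l) ^ (1 + 2 * s)) * H y :=
        lintegral_mono_set (Ioc_subset_Ioc_right (by linarith))
    _ = ENNReal.ofReal ((2 * l) ^ (1 + 2 * s)) * slobodeckij s g ^ 2 := by
        rw [lintegral_const_mul' _ _ ENNReal.ofReal_ne_top, lintegral_Ioc_periodic hHper x 0,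
          zero_add, slobodeckij_sq]

variable [NormedSpace ℝ E] [CompleteSpace E]

/-- `l` times the left-hand difference is the double integral of `g z - g y` over a square of area
`l²`, so Cauchy-Schwarz yields a bound in which `l` cancels. For `g = f'` the left side is a second
difference of `f`, of order `l^(s+1/2)`, an exponent above `1` when `s > 1/2`. -/
theorem enorm_integral_sub_integral_le {s : ℝ} (hs : 0 ≤ 1 + 2 * s) {g : ℝ → E}
    (hg : LocallyIntegrable g) (hper : Function.Periodic g 1) {x l : ℝ} (hl : 0 < l)
    (hl4 : l ≤ 1 / 4) :
    ‖(∫ z in (x + l)..(x + 2 * l), g z) - ∫ y in x..(x + l), g y‖ₑ ≤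
      ENNReal.ofReal ((2 * l) ^ (s + 1 / 2)) * slobodeckij s g := by
  rw [intervalIntegral.integral_of_le (by linarith), intervalIntegral.integral_of_le (by linarith)]
  have hi1 : IntegrableOn g (Ioc x (x + l)) :=
    (hg.integrableOn_isCompact isCompact_Icc).mono_set Ioc_subset_Icc_self
  have hi2 : IntegrableOn g (Ioc (x + l) (x + 2 * l)) :=
    (hg.integrableOn_isCompact isCompact_Icc).mono_set Ioc_subset_Icc_self
  have hv2 : volume.real (Ioc (x + l) (x + 2 * l)) = l := by
    rw [Real.volume_real_Ioc_of_le (by linarith)]; ring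
  have hv1 : volume.real (Ioc x (x + l)) = l := by
    rw [Real.volume_real_Ioc_of_le (by linarith)]; ring
  have e1 : ∀ y, ∫ z in Ioc (x + l) (x + 2 * l), (g z - g y) =
      (∫ z in Ioc (x + l) (x + 2 * l), g z) - l • g y := by
    intro y
    rw [integral_sub hi2 (by simp), setIntegral_const, hv2]
  have e2 : ∫ y in Ioc x (x + l), ∫ z in Ioc (x + l) (x + 2 * l), (g z - g y) =
      l • ((∫ z in Ioc (x + l) (x + 2 * l), g z) - ∫ y in Ioc x (x + l), g y) := by
    simp_rw [e1]
    rw [integral_sub (f := fun _ => ∫ z in Ioc (x + l) (x + 2 * l), g z) (g := fun y => l • g y)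
      (by simp) (hi1.smul l), setIntegral_const, hv1, integral_smul, smul_sub]
  have b1 : ENNReal.ofReal l * ‖(∫ z in Ioc (x + l) (x + 2 * l), g z) -
      ∫ y in Ioc x (x + l), g y‖ₑ ≤
      ∫⁻ y in Ioc x (x + l), ∫⁻ z in Ioc (x + l) (x + 2 * l), ‖g z - g y‖ₑ := by
    have : ENNReal.ofReal l = ‖l‖ₑ := by rw [Real.enorm_eq_ofReal hl.le]
    rw [this, ← enorm_smul, ← e2]
    refine (enorm_integral_le_lintegral_enorm _).trans (lintegral_mono fun y => ?_)
    exact enorm_integral_le_lintegral_enorm _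
  have hmeas : AEMeasurable (fun q : ℝ × ℝ => ‖g q.2 - g q.1‖ₑ)
      ((volume.restrict (Ioc x (x + l))).prod (volume.restrict (Ioc (x + l) (x + 2 * l)))) :=
    (hi2.aestronglyMeasurable.comp_snd.sub hi1.aestronglyMeasurable.comp_fst).enorm
  rw [← lintegral_prod (fun q : ℝ × ℝ => ‖g q.2 - g q.1‖ₑ) hmeas] at b1
  have b2 := sq_lintegral_le hmeas
  rw [lintegral_prod (fun q : ℝ × ℝ => ‖g q.2 - g q.1‖ₑ ^ 2) (hmeas.pow_const 2)] at b2
  have hμ : ((volume.restrict (Ioc x (x + l))).prod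
      (volume.restrict (Ioc (x + l) (x + 2 * l)))) univ = ENNReal.ofReal l ^ 2 := by
    rw [← univ_prod_univ, Measure.prod_prod, Measure.restrict_apply_univ,
      Measure.restrict_apply_univ, Real.volume_Ioc, Real.volume_Ioc, sq]
    congr 2 <;> ring
  rw [hμ] at b2
  have b3 := lintegral_lintegral_le_slobodeckij hs hper (x := x) hl4
  have b4 : (ENNReal.ofReal l * ‖(∫ z in Ioc (x + l) (x + 2 * l), g z) -
      ∫ y in Ioc x (x + l), g y‖ₑ) ^ 2 ≤ (ENNReal.ofReal l *
      (ENNReal.ofReal ((2 * l) ^ (s + 1 / 2)) * slobodeckij s g)) ^ 2 := by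
    refine (pow_le_pow_left' b1 2).trans (b2.trans ?_)
    rw [mul_pow]
    refine mul_le_mul_right (b3.trans (le_of_eq ?_)) _
    rw [mul_pow, ← ENNReal.ofReal_pow (by positivity), ← Real.rpow_natCast,
      ← Real.rpow_mul (by positivity)]
    congr 3
    push_cast; ring
  have b5 := (ENNReal.pow_le_pow_left_iff two_ne_zero).1 b4
  exact (ENNReal.mul_le_mul_iff_right (by simpa using hl) ENNReal.ofReal_ne_top).1 b5

end Morrey

/-! ### Embedding into `C¹` with a bound by the seminorm alone. -/

section Embedding

variable {E : Type*} [NormedAddCommGroup E]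

theorem slobodeckij_congr_ae {s : ℝ} {f g : ℝ → E} (h : f =ᵐ[volume] g) :
    slobodeckij s f = slobodeckij s g := by
  rw [slobodeckij, slobodeckij]
  congr 1
  refine lintegral_congr_ae (ae_restrict_of_ae ?_)
  filter_upwards [h] with u hu
  refine lintegral_congr_ae (ae_restrict_of_ae ?_)
  have h2 : ∀ᵐ w, f (u + w) = g (u + w) :=
    (measurePreserving_add_left volume u).quasiMeasurePreserving.ae h
  filter_upwards [h2] with w hw
  rw [hu, hw]

/-- The constant of the embedding of `W^{s,2}` into the bounded functions, on functions of mean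
value zero. -/
noncomputable def morreyConst (s : ℝ) : ℝ := 6 + 1 / (1 - (1 / 2 : ℝ) ^ (s - 1 / 2))

theorem half_rpow_lt_one {s : ℝ} (hs : 1 / 2 < s) : (1 / 2 : ℝ) ^ (s - 1 / 2) < 1 :=
  Real.rpow_lt_one (by norm_num) (by norm_num) (by linarith)

theorem morreyConst_nonneg {s : ℝ} (hs : 1 / 2 < s) : 0 ≤ morreyConst s := by
  have := half_rpow_lt_one hs
  have : 0 ≤ 1 / (1 - (1 / 2 : ℝ) ^ (s - 1 / 2)) := div_nonneg zero_le_one (by linarith)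
  unfold morreyConst
  linarith

variable [NormedSpace ℝ E]

/-- The forward difference quotient of step `2⁻⁽ᵏ⁺²⁾`. -/
noncomputable def dyadicQuotient (f : ℝ → E) (k : ℕ) (x : ℝ) : E :=
  (2 : ℝ) ^ (k + 2) • (f (x + ((2 : ℝ) ^ (k + 2))⁻¹) - f x)

section SecondDifference

variable {s N : ℝ} {f : ℝ → E}

/-- Consecutive quotients differ by `(2l)⁻¹` times a second difference with `l = 2^(-(k+3))`, that
is, by at most `(2l)^(s-1/2) N`. This is geometric in `k` exactly because `s > 1/2`. -/
theorem dist_dyadicQuotient_succ_le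
    (hD : ∀ x l : ℝ, 0 < l → l ≤ 1 / 4 →
      ‖f (x + 2 * l) - (2 : ℝ) • f (x + l) + f x‖ ≤ (2 * l) ^ (s + 1 / 2) * N)
    (hs : 1 / 2 < s) (hN : 0 ≤ N) (k : ℕ) (x : ℝ) :
    dist (dyadicQuotient f k x) (dyadicQuotient f (k + 1) x) ≤
      N * ((1 / 2 : ℝ) ^ (s - 1 / 2)) ^ k := by
  have h2 : (0 : ℝ) < 2 ^ (k + 2) := by positivity
  set l : ℝ := ((2 : ℝ) ^ (k + 3))⁻¹ with hl
  have hl0 : 0 < l := by positivity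
  have h2l : ((2 : ℝ) ^ (k + 2))⁻¹ = 2 * l := by
    rw [hl, pow_succ _ (k + 2)]; field_simp
  have hl4 : l ≤ 1 / 4 := by
    have : (4 : ℝ) ≤ 2 ^ (k + 3) := by
      rw [pow_add]
      nlinarith [one_le_pow₀ (n := k) (one_le_two : (1 : ℝ) ≤ 2)]
    rw [hl, ← one_div]
    exact one_div_le_one_div_of_le (by norm_num) this
  have e : dyadicQuotient f k x - dyadicQuotient f (k + 1) x =
      (2 : ℝ) ^ (k + 2) • (f (x + 2 * l) - (2 : ℝ) • f (x + l) + f x) := by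
    unfold dyadicQuotient
    rw [h2l, show k + 1 + 2 = k + 3 by ring, ← hl, pow_succ _ (k + 2)]
    module
  rw [dist_eq_norm, e, norm_smul, Real.norm_of_nonneg h2.le]
  have h3 := hD x l hl0 hl4
  have h4 : (2 : ℝ) ^ (k + 2) * (2 * l) ^ (s + 1 / 2) = ((1 / 2 : ℝ) ^ (s - 1 / 2)) ^ (k + 2) := by
    rw [← h2l, ← Real.rpow_natCast, ← Real.rpow_natCast, ← Real.rpow_neg zero_le_two,
      ← Real.rpow_mul zero_le_two, ← Real.rpow_add zero_lt_two, one_div,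
      Real.inv_rpow zero_le_two, ← Real.rpow_neg zero_le_two, ← Real.rpow_mul zero_le_two]
    congr 1
    push_cast; ring
  have hr0 : (0 : ℝ) ≤ (1 / 2 : ℝ) ^ (s - 1 / 2) := by positivity
  calc (2 : ℝ) ^ (k + 2) * ‖f (x + 2 * l) - (2 : ℝ) • f (x + l) + f x‖
      ≤ (2 : ℝ) ^ (k + 2) * ((2 * l) ^ (s + 1 / 2) * N) := by gcongr
    _ = ((1 / 2 : ℝ) ^ (s - 1 / 2)) ^ (k + 2) * N := by rw [← mul_assoc, h4]
    _ ≤ ((1 / 2 : ℝ) ^ (s - 1 / 2)) ^ k * N := by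
      refine mul_le_mul_of_nonneg_right ?_ hN
      exact pow_le_pow_of_le_one hr0 (half_rpow_lt_one hs).le (by omega)
    _ = _ := mul_comm _ _

/-- On the cyclic grid of step `1/4`, a first difference is a combination of second differences:
with `aᵢ = f(x + i/4)` and `a₄ = a₀`, four times `a₁ - a₀` is minus the combination with weights `3,
2, 1` of the second differences starting at `a₀, a₁, a₂`. The weights sum to `6`. Periodicity is
what removes any lower-order term. -/
theorem norm_dyadicQuotient_zero_le
    (hD : ∀ x l : ℝ, 0 < l → l ≤ 1 / 4 →
      ‖f (x + 2 * l) - (2 : ℝ) • f (x + l) + f x‖ ≤ (2 * l) ^ (s + 1 / 2) * N)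
    (hs : 1 / 2 < s) (hN : 0 ≤ N)
    (hper : Function.Periodic f 1) (x : ℝ) : ‖dyadicQuotient f 0 x‖ ≤ 6 * N := by
  have h : ∀ y, ‖f (y + 1 / 2) - (2 : ℝ) • f (y + 1 / 4) + f y‖ ≤ N := by
    intro y
    have := hD y (1 / 4) (by norm_num) le_rfl
    norm_num at this
    norm_num
    refine this.trans (mul_le_of_le_one_left hN ?_)
    exact Real.rpow_le_one (by norm_num) (by norm_num) (by linarith)
  have e : dyadicQuotient f 0 x =
      -((3 : ℝ) • (f (x + 1 / 2) - (2 : ℝ) • f (x + 1 / 4) + f x) +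
        (2 : ℝ) • (f (x + 1 / 4 + 1 / 2) - (2 : ℝ) • f (x + 1 / 4 + 1 / 4) + f (x + 1 / 4)) +
        (f (x + 1 / 2 + 1 / 2) - (2 : ℝ) • f (x + 1 / 2 + 1 / 4) + f (x + 1 / 2))) := by
    unfold dyadicQuotient
    rw [show x + 1 / 2 + 1 / 2 = x + 1 by ring, hper,
      show x + 1 / 4 + 1 / 4 = x + 1 / 2 by ring,
      show x + 1 / 4 + 1 / 2 = x + 1 / 2 + 1 / 4 by ring]
    norm_num
    module
  rw [e, norm_neg]
  refine (norm_add₃_le).trans ?_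
  rw [norm_smul, norm_smul, Real.norm_of_nonneg (by norm_num), Real.norm_of_nonneg (by norm_num)]
  linarith [h x, h (x + 1 / 4), h (x + 1 / 2)]

/-- A continuous function with small second differences is continuously differentiable along
dyadic difference quotients. -/
theorem exists_tendsto_dyadicQuotient [CompleteSpace E]
    (hD : ∀ x l : ℝ, 0 < l → l ≤ 1 / 4 →
      ‖f (x + 2 * l) - (2 : ℝ) • f (x + l) + f x‖ ≤ (2 * l) ^ (s + 1 / 2) * N)
    (hs : 1 / 2 < s) (hN : 0 ≤ N)
    (hf : Continuous f) (hper : Function.Periodic f 1) :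
    ∃ G : ℝ → E, Continuous G ∧ (∀ x, Tendsto (fun k => dyadicQuotient f k x) atTop (𝓝 (G x))) ∧
      ∀ x, ‖G x‖ ≤ morreyConst s * N := by
  set r : ℝ := (1 / 2 : ℝ) ^ (s - 1 / 2) with hr
  have hr1 : r < 1 := half_rpow_lt_one hs
  have hr0 : 0 ≤ r := by positivity
  have hstep := fun k x => dist_dyadicQuotient_succ_le hD hs hN k x
  have hc : ∀ x, ∃ y, Tendsto (fun k => dyadicQuotient f k x) atTop (𝓝 y) := fun x =>
    cauchySeq_tendsto_of_complete (cauchySeq_of_le_geometric r N hr1 fun k => hstep k x)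
  choose G hG using hc
  have hdist : ∀ x k, dist (dyadicQuotient f k x) (G x) ≤ N * r ^ k / (1 - r) := fun x k =>
    dist_le_of_le_geometric_of_tendsto r N hr1 (fun k => hstep k x) (hG x) k
  refine ⟨G, ?_, hG, fun x => ?_⟩
  · have hu : TendstoUniformly (dyadicQuotient f) G atTop := by
      rw [Metric.tendstoUniformly_iff]
      intro ε hε
      have h0 : Tendsto (fun k : ℕ => N * r ^ k / (1 - r)) atTop (𝓝 0) := by
        simpa using ((tendsto_pow_atTop_nhds_zero_of_lt_one hr0 hr1).const_mul N).div_const (1 - r)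
      filter_upwards [h0.eventually_lt_const hε] with k hk x
      rw [dist_comm]
      exact (hdist x k).trans_lt hk
    refine hu.continuous (Frequently.of_forall fun k => ?_)
    unfold dyadicQuotient
    fun_prop
  · have h1 := hdist x 0
    have h2 := norm_dyadicQuotient_zero_le hD hs hN hper x
    rw [dist_eq_norm] at h1
    have h3 : ‖G x‖ ≤ ‖dyadicQuotient f 0 x‖ + ‖dyadicQuotient f 0 x - G x‖ := by
      have := norm_sub_le (dyadicQuotient f 0 x) (dyadicQuotient f 0 x - G x)
      simpa using this
    rw [pow_zero, mul_one] at h1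
    have : morreyConst s * N = 6 * N + N / (1 - r) := by
      rw [morreyConst, ← hr]; ring
    linarith

end SecondDifference

variable [CompleteSpace E]

/-- Functions in `W^{1+s,2}`, `s > 1/2`, are continuously differentiable, with a derivative bounded
by its seminorm. -/
theorem MemW.contDiff_and_bound {s : ℝ} (hs : 1 / 2 < s) {f : ℝ → E} (h : MemW s f) :
    ContDiff ℝ 1 f ∧ slobodeckij s (deriv f) ≠ ⊤ ∧
      ∀ u, ‖deriv f u‖ ≤ morreyConst s * slobodeckijReal s (deriv f) := by
  obtain ⟨hper, hf, g, hgper, hw, -, hfin⟩ := h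
  have hg : LocallyIntegrable g := hw.2.1
  have hii : ∀ a b, IntervalIntegrable g volume a b := fun a b =>
    intervalIntegrable_iff.2
      ((hg.integrableOn_isCompact isCompact_uIcc).mono_set uIoc_subset_uIcc)
  have hD : ∀ x l : ℝ, 0 < l → l ≤ 1 / 4 → ‖f (x + 2 * l) - (2 : ℝ) • f (x + l) + f x‖ ≤
      (2 * l) ^ (s + 1 / 2) * slobodeckijReal s g := by
    intro x l hl hl4
    have h1 := enorm_integral_sub_integral_le (s := s) (by linarith) hg hgper (x := x) hl hl4
    rw [← hw.sub_eq_integral hf (by linarith), ← hw.sub_eq_integral hf (by linarith)] at h1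
    have h2 := ENNReal.toReal_mono (ENNReal.mul_ne_top ENNReal.ofReal_ne_top hfin) h1
    rw [toReal_enorm, ENNReal.toReal_mul, ENNReal.toReal_ofReal (by positivity)] at h2
    refine le_trans (le_of_eq ?_) h2
    congr 1
    module
  obtain ⟨G, hGc, hG, hGb⟩ := exists_tendsto_dyadicQuotient hD hs ENNReal.toReal_nonneg hf hper
  -- By Lebesgue differentiation `f` has derivative `g x` at almost every `x`, and there the dyadic
  -- quotients converge to `g x` as well as to `G x`.
  have hae : g =ᵐ[volume] G := by
    filter_upwards [LocallyIntegrable.ae_hasDerivAt_integral hg] with x hx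
    have hx1 : HasDerivAt f (g x) x := by
      have h1 := (hx (x - 1)).add_const (f (x - 1))
      refine h1.congr_of_eventuallyEq ?_
      filter_upwards [Ioi_mem_nhds (show x - 1 < x by linarith)] with y hy
      rw [← hw.sub_eq_integral hf (le_of_lt hy), sub_add_cancel]
    have hx2 := hx1.tendsto_slope
    have hx3 : Tendsto (fun k : ℕ => x + ((2 : ℝ) ^ (k + 2))⁻¹) atTop (𝓝[≠] x) := by
      rw [tendsto_nhdsWithin_iff]
      constructor
      · have : Tendsto (fun k : ℕ => ((2 : ℝ) ^ (k + 2))⁻¹) atTop (𝓝 0) :=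
          tendsto_inv_atTop_zero.comp
            ((tendsto_pow_atTop_atTop_of_one_lt one_lt_two).comp (tendsto_add_atTop_nat 2))
        simpa using this.const_add x
      · refine Eventually.of_forall fun k => ?_
        simp
    refine tendsto_nhds_unique ((hx2.comp hx3).congr fun k => ?_) (hG x)
    simp [slope, dyadicQuotient]
  -- Now `f` is a primitive of the continuous function `G`, so it is differentiable at every point.
  have hderiv : ∀ x, HasDerivAt f (G x) x := by
    intro x
    have h1 : HasDerivAt (fun y => ∫ t in (x - 1)..y, G t) (G x) x :=
      intervalIntegral.integral_hasDerivAt_right (hGc.intervalIntegrable _ _)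
        (hGc.stronglyMeasurableAtFilter _ _) hGc.continuousAt
    refine (h1.add_const (f (x - 1))).congr_of_eventuallyEq ?_
    filter_upwards [Ioi_mem_nhds (show x - 1 < x by linarith)] with y hy
    rw [← intervalIntegral.integral_congr_ae (hae.mono fun z hz _ => hz),
      ← hw.sub_eq_integral hf (le_of_lt hy), sub_add_cancel]
  have hdG : deriv f = G := funext fun x => (hderiv x).deriv
  have hslob : slobodeckij s (deriv f) = slobodeckij s g := by
    rw [hdG]; exact (slobodeckij_congr_ae hae).symm
  refine ⟨?_, hslob ▸ hfin, fun u => ?_⟩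
  · rw [contDiff_one_iff_deriv]
    exact ⟨fun x => (hderiv x).differentiableAt, hdG ▸ hGc⟩
  · rw [slobodeckijReal, hslob, hdG]
    exact hGb u

end Embedding

/-! ### Pointwise calculus of `(y, e) ↦ B y e e`. -/

section QuadraticIntegral

set_option maxSynthPendingDepth 3

variable {Y E : Type*} [NormedAddCommGroup Y] [NormedSpace ℝ Y]
  [NormedAddCommGroup E] [NormedSpace ℝ E]

/-- The derivative of `(y, e) ↦ B y e e` at `(y, e)` in the direction `(η, ε)`. -/
noncomputable def quadDeriv (B : Y → E →L[ℝ] E →L[ℝ] ℝ) (y : Y) (e : E) (η : Y) (ε : E) : ℝ :=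
  fderiv ℝ B y η e e + (B y ε e + B y e ε)

/-- The second derivative of `(y, e) ↦ B y e e` at `(y, e)` in the directions `(η, ε)` and
`(η', ε')`. -/
noncomputable def quadDeriv₂ (B : Y → E →L[ℝ] E →L[ℝ] ℝ) (y : Y) (e : E) (η : Y) (ε : E)
    (η' : Y) (ε' : E) : ℝ :=
  fderiv ℝ (fderiv ℝ B) y η' η e e + (fderiv ℝ B y η ε' e + fderiv ℝ B y η e ε') +
    (fderiv ℝ B y η' ε e + B y ε ε' + (fderiv ℝ B y η' e ε + B y ε' ε))

variable {B : Y → E →L[ℝ] E →L[ℝ] ℝ}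

theorem abs_apply_apply_le (L : E →L[ℝ] E →L[ℝ] ℝ) {c : ℝ} (hL : ‖L‖ ≤ c) (e e' : E) :
    |L e e'| ≤ c * (‖e‖ * ‖e'‖) := by
  rw [← Real.norm_eq_abs, ← mul_assoc]
  exact (L.le_opNorm₂ e e').trans (by gcongr)

theorem abs_quadDeriv_le {y : Y} {c m : ℝ} (h0 : ‖B y‖ ≤ c) (h1 : ‖fderiv ℝ B y‖ ≤ c)
    (e : E) {η : Y} (hη : ‖η‖ ≤ m) (ε : E) :
    |quadDeriv B y e η ε| ≤ c * (m * ‖e‖ ^ 2 + 2 * (‖e‖ * ‖ε‖)) := by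
  have hc : 0 ≤ c := (norm_nonneg _).trans h0
  have a1 : ‖fderiv ℝ B y η‖ ≤ c * m := (ContinuousLinearMap.le_opNorm _ _).trans (by gcongr)
  have b1 := abs_apply_apply_le _ a1 e e
  have b2 := abs_apply_apply_le _ h0 ε e
  have b3 := abs_apply_apply_le _ h0 e ε
  unfold quadDeriv
  refine (abs_add_le _ _).trans ?_
  have := abs_add_le (B y ε e) (B y e ε)
  nlinarith

theorem abs_quadDeriv₂_le {y : Y} {c m m' : ℝ} (h0 : ‖B y‖ ≤ c) (h1 : ‖fderiv ℝ B y‖ ≤ c)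
    (h2 : ‖fderiv ℝ (fderiv ℝ B) y‖ ≤ c) (e : E) {η η' : Y} (hη : ‖η‖ ≤ m) (hη' : ‖η'‖ ≤ m')
    (ε ε' : E) :
    |quadDeriv₂ B y e η ε η' ε'| ≤ c * (m * m' * ‖e‖ ^ 2 + 2 * m * (‖e‖ * ‖ε'‖) +
      2 * m' * (‖e‖ * ‖ε‖) + 2 * (‖ε‖ * ‖ε'‖)) := by
  have hc : 0 ≤ c := (norm_nonneg _).trans h0
  have hm : 0 ≤ m := (norm_nonneg _).trans hη
  have hm' : 0 ≤ m' := (norm_nonneg _).trans hη'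
  have a1 : ‖fderiv ℝ B y η‖ ≤ c * m := (ContinuousLinearMap.le_opNorm _ _).trans (by gcongr)
  have a2 : ‖fderiv ℝ B y η'‖ ≤ c * m' := (ContinuousLinearMap.le_opNorm _ _).trans (by gcongr)
  have a3 : ‖fderiv ℝ (fderiv ℝ B) y η' η‖ ≤ c * m' * m :=
    (ContinuousLinearMap.le_opNorm₂ _ _ _).trans (by gcongr)
  have b1 := abs_apply_apply_le _ a3 e e
  have b2 := abs_apply_apply_le _ a1 ε' e
  have b3 := abs_apply_apply_le _ a1 e ε'
  have b4 := abs_apply_apply_le _ a2 ε e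
  have b5 := abs_apply_apply_le _ h0 ε ε'
  have b6 := abs_apply_apply_le _ a2 e ε
  have b7 := abs_apply_apply_le _ h0 ε' ε
  unfold quadDeriv₂
  rw [abs_le] at *
  constructor <;> nlinarith

/-- The common control of `B` and its first two derivatives on a set. -/
def C2Bound (B : Y → E →L[ℝ] E →L[ℝ] ℝ) (K : Set Y) (c : ℝ) : Prop :=
  ∀ y ∈ K, ‖B y‖ ≤ c ∧ ‖fderiv ℝ B y‖ ≤ c ∧ ‖fderiv ℝ (fderiv ℝ B) y‖ ≤ c

section Smooth

variable {U : Set Y}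

theorem exists_C2Bound (hU : IsOpen U) (hB : ContDiffOn ℝ 2 B U) {K : Set Y} (hK : IsCompact K)
    (hKU : K ⊆ U) : ∃ c, C2Bound B K c := by
  have hB1 : ContDiffOn ℝ 1 (fderiv ℝ B) U :=
    hB.fderiv_of_isOpen hU (by norm_num)
  have hB2 : ContinuousOn (fderiv ℝ (fderiv ℝ B)) U :=
    hB1.continuousOn_fderiv_of_isOpen hU (by norm_num)
  obtain ⟨c0, h0⟩ := hK.exists_bound_of_continuousOn (hB.continuousOn.mono hKU)
  obtain ⟨c1, h1⟩ := hK.exists_bound_of_continuousOn (hB1.continuousOn.mono hKU)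
  obtain ⟨c2, h2⟩ := hK.exists_bound_of_continuousOn
    (E := Y →L[ℝ] Y →L[ℝ] E →L[ℝ] E →L[ℝ] ℝ) (hB2.mono hKU)
  refine ⟨max c0 (max c1 c2), fun y hy => ⟨?_, ?_, ?_⟩⟩
  · exact (h0 y hy).trans (by simp)
  · exact (h1 y hy).trans (by simp)
  · exact (h2 y hy).trans (by simp)

theorem hasDerivAt_quad (hU : IsOpen U) (hB : ContDiffOn ℝ 2 B U) {y η : Y} {e ε : E} {τ : ℝ}
    (hy : y + τ • η ∈ U) :
    HasDerivAt (fun τ : ℝ => B (y + τ • η) (e + τ • ε) (e + τ • ε))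
      (quadDeriv B (y + τ • η) (e + τ • ε) η ε) τ := by
  have hBd : HasFDerivAt B (fderiv ℝ B (y + τ • η)) (y + τ • η) :=
    ((hB.differentiableOn (by norm_num)).differentiableAt (hU.mem_nhds hy)).hasFDerivAt
  have l1 : HasDerivAt (fun τ : ℝ => y + τ • η) η τ := by
    simpa using ((hasDerivAt_id τ).smul_const η).const_add y
  have l2 : HasDerivAt (fun τ : ℝ => e + τ • ε) ε τ := by
    simpa using ((hasDerivAt_id τ).smul_const ε).const_add e
  have h1 := hBd.comp_hasDerivAt τ l1
  have h2 := (h1.clm_apply l2).clm_apply l2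
  refine h2.congr_deriv ?_
  simp only [quadDeriv, add_apply, Function.comp]
  ring

theorem hasDerivAt_quadDeriv (hU : IsOpen U) (hB : ContDiffOn ℝ 2 B U) {y η η' : Y}
    {e ε ε' : E} {τ : ℝ} (hy : y + τ • η' ∈ U) :
    HasDerivAt (fun τ : ℝ => quadDeriv B (y + τ • η') (e + τ • ε') η ε)
      (quadDeriv₂ B (y + τ • η') (e + τ • ε') η ε η' ε') τ := by
  have hBd : HasFDerivAt B (fderiv ℝ B (y + τ • η')) (y + τ • η') :=
    ((hB.differentiableOn (by norm_num)).differentiableAt (hU.mem_nhds hy)).hasFDerivAt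
  have hB1 : ContDiffOn ℝ 1 (fderiv ℝ B) U := hB.fderiv_of_isOpen hU (by norm_num)
  have hBd1 : HasFDerivAt (fderiv ℝ B) (fderiv ℝ (fderiv ℝ B) (y + τ • η')) (y + τ • η') :=
    ((hB1.differentiableOn (by norm_num)).differentiableAt (hU.mem_nhds hy)).hasFDerivAt
  have l1 : HasDerivAt (fun τ : ℝ => y + τ • η') η' τ := by
    simpa using ((hasDerivAt_id τ).smul_const η').const_add y
  have l2 : HasDerivAt (fun τ : ℝ => e + τ • ε') ε' τ := by
    simpa using ((hasDerivAt_id τ).smul_const ε').const_add e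
  have h1 := hBd.comp_hasDerivAt τ l1
  have h1' := hBd1.comp_hasDerivAt τ l1
  have t1 := ((h1'.clm_apply (hasDerivAt_const τ η)).clm_apply l2).clm_apply l2
  have t2 := (h1.clm_apply (hasDerivAt_const τ ε)).clm_apply l2
  have t3 := (h1.clm_apply l2).clm_apply (hasDerivAt_const τ ε)
  refine (t1.add (t2.add t3)).congr_deriv ?_
  simp only [quadDeriv₂, add_apply, Function.comp, map_zero,
    zero_apply]
  ring

end Smooth

end QuadraticIntegral

/-! ### Differentiation of `∫ B(y)(e, e)` under the integral sign. -/

section QuadraticIntegralVariation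

set_option maxSynthPendingDepth 3

variable {X : Type*} [MeasurableSpace X] {ν : Measure X}

/-- `h` need not be measurable off `U`, but the law of `y` is carried by `U`, so restricting it to
`U` changes nothing. -/
theorem aestronglyMeasurable_comp_of_continuousOn {Y Z : Type*} [TopologicalSpace Y]
    [SecondCountableTopology Y] [MeasurableSpace Y] [OpensMeasurableSpace Y]
    [TopologicalSpace.PseudoMetrizableSpace Y]
    [TopologicalSpace Z] [TopologicalSpace.PseudoMetrizableSpace Z]
    {U : Set Y} (hU : IsOpen U) {h : Y → Z}
    (hh : ContinuousOn h U) {y : X → Y} (hy : AEMeasurable y ν) (hyU : ∀ᵐ x ∂ν, y x ∈ U) :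
    AEStronglyMeasurable (fun x => h (y x)) ν := by
  have h1 : AEStronglyMeasurable h ((ν.map y).restrict U) :=
    hh.aestronglyMeasurable hU.measurableSet
  have h2 : (ν.map y).restrict U = ν.map y := by
    refine Measure.restrict_eq_self_of_ae_mem ?_
    exact (ae_map_iff hy hU.measurableSet).2 hyU
  rw [h2] at h1
  exact h1.comp_aemeasurable hy

theorem integral_norm_mul_norm_le {E F : Type*} [NormedAddCommGroup E] [NormedAddCommGroup F]
    {e : X → E} {ε : X → F} (he : MemLp e 2 ν) (hε : MemLp ε 2 ν) {N N' : ℝ} (hN : 0 ≤ N)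
    (hN' : 0 ≤ N') (heN : ∫ x, ‖e x‖ ^ 2 ∂ν ≤ N ^ 2) (hεN : ∫ x, ‖ε x‖ ^ 2 ∂ν ≤ N' ^ 2) :
    ∫ x, ‖e x‖ * ‖ε x‖ ∂ν ≤ N * N' := by
  have h := integral_mul_le_Lp_mul_Lq_of_nonneg (μ := ν) Real.HolderConjugate.two_two
    (f := fun x => ‖e x‖) (g := fun x => ‖ε x‖)
    (Eventually.of_forall fun x => norm_nonneg _) (Eventually.of_forall fun x => norm_nonneg _)
    (by simpa using he.norm) (by simpa using hε.norm)
  simp only [Real.rpow_two, ← Real.sqrt_eq_rpow] at h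
  refine h.trans (mul_le_mul ?_ ?_ (Real.sqrt_nonneg _) hN)
  · exact (Real.sqrt_le_sqrt heN).trans (Real.sqrt_sq hN).le
  · exact (Real.sqrt_le_sqrt hεN).trans (Real.sqrt_sq hN').le

theorem integrable_norm_mul_norm {E F : Type*} [NormedAddCommGroup E] [NormedAddCommGroup F]
    {e : X → E} {ε : X → F} (he : MemLp e 2 ν) (hε : MemLp ε 2 ν) :
    Integrable (fun x => ‖e x‖ * ‖ε x‖) ν :=
  he.norm.integrable_mul hε.norm

variable {Y E : Type*} [NormedAddCommGroup Y] [NormedSpace ℝ Y]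
  [NormedAddCommGroup E] [NormedSpace ℝ E]
  {B : Y → E →L[ℝ] E →L[ℝ] ℝ} {U K : Set Y} {y η η' : X → Y} {e ε ε' : X → E} {m m' c : ℝ}

theorem norm_add_smul_le {τ : ℝ} (hτ : |τ| ≤ 1) (e ε : E) : ‖e + τ • ε‖ ≤ ‖e‖ + ‖ε‖ := by
  refine (norm_add_le _ _).trans ?_
  rw [norm_smul, Real.norm_eq_abs]
  have := mul_le_of_le_one_left (norm_nonneg ε) hτ
  linarith

/-- `η` enters through its sup bound `m`, while `e` and `ε` enter through their `L²` bounds and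
Cauchy-Schwarz; each term is thus linear in the size of the direction `(η, ε)`. -/
theorem abs_integral_quadDeriv_le (hc : C2Bound B K c) (hc0 : 0 ≤ c) (hm : 0 ≤ m)
    (hyK : ∀ᵐ x ∂ν, y x ∈ K) (he : MemLp e 2 ν) (hηm : ∀ᵐ x ∂ν, ‖η x‖ ≤ m) (hε : MemLp ε 2 ν)
    {N N₁ : ℝ} (hN : 0 ≤ N) (hN₁ : 0 ≤ N₁) (heN : ∫ x, ‖e x‖ ^ 2 ∂ν ≤ N ^ 2)
    (hεN : ∫ x, ‖ε x‖ ^ 2 ∂ν ≤ N₁ ^ 2) :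
    |∫ x, quadDeriv B (y x) (e x) (η x) (ε x) ∂ν| ≤ c * (m * N ^ 2 + 2 * (N * N₁)) := by
  have i1 := he.norm.integrable_sq.const_mul m
  have i2 := (integrable_norm_mul_norm he hε).const_mul 2
  have h := norm_integral_le_of_norm_le (f := fun x => quadDeriv B (y x) (e x) (η x) (ε x))
    ((i1.add i2).const_mul c) (μ := ν) ?_
  · refine h.trans ?_
    simp only [Pi.add_apply]
    rw [integral_const_mul, integral_add i1 i2, integral_const_mul, integral_const_mul]
    have := integral_norm_mul_norm_le he hε hN hN₁ heN hεN
    gcongr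
  · filter_upwards [hyK, hηm] with x h1 h2
    exact abs_quadDeriv_le (hc _ h1).1 (hc _ h1).2.1 _ h2 _

theorem abs_integral_quadDeriv₂_le (hc : C2Bound B K c) (hc0 : 0 ≤ c) (hm : 0 ≤ m) (hm' : 0 ≤ m')
    (hyK : ∀ᵐ x ∂ν, y x ∈ K) (he : MemLp e 2 ν) (hηm : ∀ᵐ x ∂ν, ‖η x‖ ≤ m) (hε : MemLp ε 2 ν)
    (hηm' : ∀ᵐ x ∂ν, ‖η' x‖ ≤ m') (hε' : MemLp ε' 2 ν)
    {N N₁ N₂ : ℝ} (hN : 0 ≤ N) (hN₁ : 0 ≤ N₁) (hN₂ : 0 ≤ N₂) (heN : ∫ x, ‖e x‖ ^ 2 ∂ν ≤ N ^ 2)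
    (hεN : ∫ x, ‖ε x‖ ^ 2 ∂ν ≤ N₁ ^ 2) (hεN' : ∫ x, ‖ε' x‖ ^ 2 ∂ν ≤ N₂ ^ 2) :
    |∫ x, quadDeriv₂ B (y x) (e x) (η x) (ε x) (η' x) (ε' x) ∂ν| ≤
      c * (m * m' * N ^ 2 + 2 * m * (N * N₂) + 2 * m' * (N * N₁) + 2 * (N₁ * N₂)) := by
  have i1 := he.norm.integrable_sq.const_mul (m * m')
  have i2 := (integrable_norm_mul_norm he hε').const_mul (2 * m)
  have i3 := (integrable_norm_mul_norm he hε).const_mul (2 * m')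
  have i4 := (integrable_norm_mul_norm hε hε').const_mul 2
  have h := norm_integral_le_of_norm_le
    (f := fun x => quadDeriv₂ B (y x) (e x) (η x) (ε x) (η' x) (ε' x))
    ((((i1.add i2).add i3).add i4).const_mul c) (μ := ν) ?_
  · refine h.trans ?_
    rw [integral_const_mul, integral_add' ((i1.add i2).add i3) i4, integral_add' (i1.add i2) i3,
      integral_add' i1 i2, integral_const_mul, integral_const_mul, integral_const_mul,
      integral_const_mul]
    have := integral_norm_mul_norm_le he hε hN hN₁ heN hεN
    have := integral_norm_mul_norm_le he hε' hN hN₂ heN hεN'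
    have := integral_norm_mul_norm_le hε hε' hN₁ hN₂ hεN hεN'
    gcongr
  · filter_upwards [hyK, hηm, hηm'] with x h1 h2 h2'
    exact abs_quadDeriv₂_le (hc _ h1).1 (hc _ h1).2.1 (hc _ h1).2.2 _ h2 h2' _ _

variable [FiniteDimensional ℝ Y]

/-- A bounded perturbation of a map into a compact subset of an open set stays in a compact
subset of it. -/
theorem exists_isCompact_eventually_mem (hU : IsOpen U) (hK : IsCompact K) (hKU : K ⊆ U) (m : ℝ) :
    ∃ K' : Set Y, IsCompact K' ∧ K' ⊆ U ∧ ∀ᶠ τ : ℝ in 𝓝 0, ∀ y η : Y, y ∈ K → ‖η‖ ≤ m →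
      y + τ • η ∈ K' := by
  have : ProperSpace Y := FiniteDimensional.proper_real Y
  obtain ⟨δ, hδ, hδU⟩ := hK.exists_cthickening_subset_open hU hKU
  refine ⟨Metric.cthickening δ K, hK.cthickening, hδU, ?_⟩
  have h0 : Tendsto (fun τ : ℝ => |τ| * m) (𝓝 0) (𝓝 0) := by
    have : Continuous fun τ : ℝ => |τ| * m := by fun_prop
    simpa using this.tendsto 0
  filter_upwards [h0.eventually_le_const hδ] with τ hτ y η hy hη
  refine Metric.mem_cthickening_of_dist_le _ y _ _ hy ?_
  rw [dist_eq_norm, add_sub_cancel_left, norm_smul, Real.norm_eq_abs]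
  exact (mul_le_mul_of_nonneg_left hη (abs_nonneg _)).trans hτ

variable [MeasurableSpace Y] [BorelSpace Y]

theorem aestronglyMeasurable_quad (hU : IsOpen U) (hB : ContDiffOn ℝ 2 B U)
    (hy : AEMeasurable y ν) (hyU : ∀ᵐ x ∂ν, y x ∈ U) (he : AEStronglyMeasurable e ν)
    (hε : AEStronglyMeasurable ε ν) :
    AEStronglyMeasurable (fun x => B (y x) (e x) (ε x)) ν := by
  have : SecondCountableTopology Y :=
    have := FiniteDimensional.proper_real Y
    inferInstance
  have h1 := aestronglyMeasurable_comp_of_continuousOn hU hB.continuousOn hy hyU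
  have h2 : AEStronglyMeasurable (fun x => B (y x) (e x)) ν :=
    (ContinuousLinearMap.id ℝ (E →L[ℝ] E →L[ℝ] ℝ)).aestronglyMeasurable_comp₂ h1 he
  exact (ContinuousLinearMap.id ℝ (E →L[ℝ] ℝ)).aestronglyMeasurable_comp₂ h2 hε

theorem aestronglyMeasurable_quadDeriv (hU : IsOpen U) (hB : ContDiffOn ℝ 2 B U)
    (hy : AEMeasurable y ν) (hyU : ∀ᵐ x ∂ν, y x ∈ U) (he : AEStronglyMeasurable e ν)
    (hη : AEMeasurable η ν) (hε : AEStronglyMeasurable ε ν) :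
    AEStronglyMeasurable (fun x => quadDeriv B (y x) (e x) (η x) (ε x)) ν := by
  have : SecondCountableTopology Y :=
    have := FiniteDimensional.proper_real Y
    inferInstance
  have hB1 : ContinuousOn (fderiv ℝ B) U :=
    (hB.fderiv_of_isOpen hU (m := 1) (by norm_num)).continuousOn
  have h1 := aestronglyMeasurable_comp_of_continuousOn hU hB1 hy hyU
  have h2 : AEStronglyMeasurable (fun x => fderiv ℝ B (y x) (η x)) ν :=
    (ContinuousLinearMap.id ℝ (Y →L[ℝ] E →L[ℝ] E →L[ℝ] ℝ)).aestronglyMeasurable_comp₂ h1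
      hη.aestronglyMeasurable
  have h3 : AEStronglyMeasurable (fun x => fderiv ℝ B (y x) (η x) (e x)) ν :=
    (ContinuousLinearMap.id ℝ (E →L[ℝ] E →L[ℝ] ℝ)).aestronglyMeasurable_comp₂ h2 he
  have h4 : AEStronglyMeasurable (fun x => fderiv ℝ B (y x) (η x) (e x) (e x)) ν :=
    (ContinuousLinearMap.id ℝ (E →L[ℝ] ℝ)).aestronglyMeasurable_comp₂ h3 he
  exact h4.add ((aestronglyMeasurable_quad hU hB hy hyU hε he).add
    (aestronglyMeasurable_quad hU hB hy hyU he hε))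

theorem aestronglyMeasurable_fderiv_fderiv {F : Type*} [NormedAddCommGroup F] [NormedSpace ℝ F]
    {h : Y → F} (hU : IsOpen U) (hh : ContDiffOn ℝ 2 h U)
    (hy : AEMeasurable y ν) (hyU : ∀ᵐ x ∂ν, y x ∈ U) (hη : AEMeasurable η ν)
    (hη' : AEMeasurable η' ν) :
    AEStronglyMeasurable (fun x => fderiv ℝ (fderiv ℝ h) (y x) (η' x) (η x)) ν := by
  have : SecondCountableTopology Y :=
    have := FiniteDimensional.proper_real Y
    inferInstance
  have hh1 : ContDiffOn ℝ 1 (fderiv ℝ h) U := hh.fderiv_of_isOpen hU (by norm_num)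
  have hh2 : ContinuousOn (fderiv ℝ (fderiv ℝ h)) U :=
    hh1.continuousOn_fderiv_of_isOpen hU (by norm_num)
  have h2 := aestronglyMeasurable_comp_of_continuousOn hU hh2 hy hyU
  have a3 : AEStronglyMeasurable (fun x => fderiv ℝ (fderiv ℝ h) (y x) (η' x)) ν :=
    (ContinuousLinearMap.id ℝ (Y →L[ℝ] Y →L[ℝ] F)).aestronglyMeasurable_comp₂ h2
      hη'.aestronglyMeasurable
  exact (ContinuousLinearMap.id ℝ (Y →L[ℝ] F)).aestronglyMeasurable_comp₂ a3
    hη.aestronglyMeasurable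

theorem aestronglyMeasurable_quadDeriv₂ (hU : IsOpen U) (hB : ContDiffOn ℝ 2 B U)
    (hy : AEMeasurable y ν) (hyU : ∀ᵐ x ∂ν, y x ∈ U) (he : AEStronglyMeasurable e ν)
    (hη : AEMeasurable η ν) (hε : AEStronglyMeasurable ε ν)
    (hη' : AEMeasurable η' ν) (hε' : AEStronglyMeasurable ε' ν) :
    AEStronglyMeasurable (fun x => quadDeriv₂ B (y x) (e x) (η x) (ε x) (η' x) (ε' x)) ν := by
  have : SecondCountableTopology Y :=
    have := FiniteDimensional.proper_real Y
    inferInstance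
  have hB1' : ContDiffOn ℝ 1 (fderiv ℝ B) U := hB.fderiv_of_isOpen hU (by norm_num)
  have h1 := aestronglyMeasurable_comp_of_continuousOn hU hB1'.continuousOn hy hyU
  have a2 : ∀ {ζ : X → Y}, AEMeasurable ζ ν →
      AEStronglyMeasurable (fun x => fderiv ℝ B (y x) (ζ x)) ν := fun hζ =>
    (ContinuousLinearMap.id ℝ (Y →L[ℝ] E →L[ℝ] E →L[ℝ] ℝ)).aestronglyMeasurable_comp₂ h1
      hζ.aestronglyMeasurable
  have a4 := aestronglyMeasurable_fderiv_fderiv hU hB hy hyU hη hη'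
  have ev : ∀ {L : X → E →L[ℝ] E →L[ℝ] ℝ} {e₁ e₂ : X → E}, AEStronglyMeasurable L ν →
      AEStronglyMeasurable e₁ ν → AEStronglyMeasurable e₂ ν →
      AEStronglyMeasurable (fun x => L x (e₁ x) (e₂ x)) ν := fun hL h₁ h₂ =>
    (ContinuousLinearMap.id ℝ (E →L[ℝ] ℝ)).aestronglyMeasurable_comp₂
      ((ContinuousLinearMap.id ℝ (E →L[ℝ] E →L[ℝ] ℝ)).aestronglyMeasurable_comp₂ hL h₁) h₂
  exact ((ev a4 he he).add ((ev (a2 hη) hε' he).add (ev (a2 hη) he hε'))).add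
    (((ev (a2 hη') hε he).add (aestronglyMeasurable_quad hU hB hy hyU hε hε')).add
      ((ev (a2 hη') he hε).add (aestronglyMeasurable_quad hU hB hy hyU hε' hε)))

theorem integrable_quad (hU : IsOpen U) (hB : ContDiffOn ℝ 2 B U) (hK : IsCompact K)
    (hKU : K ⊆ U) (hy : AEMeasurable y ν) (hyK : ∀ᵐ x ∂ν, y x ∈ K) (he : MemLp e 2 ν) :
    Integrable (fun x => B (y x) (e x) (e x)) ν := by
  obtain ⟨c, hc⟩ := exists_C2Bound hU hB hK hKU
  refine ((integrable_norm_mul_norm he he).const_mul c).mono'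
    (aestronglyMeasurable_quad hU hB hy (hyK.mono fun x hx => hKU hx) he.1 he.1) ?_
  filter_upwards [hyK] with x hx
  exact abs_apply_apply_le _ (hc _ hx).1 _ _

/-- For small `τ` the points `y + τη` stay in one compact `K' ⊆ U`, on which `B` and `DB` have a
common bound `c`. For `|τ| ≤ 1` the derivative is then dominated by `c (m + 2) (‖e‖ + ‖ε‖)²`,
integrable because `e` and `ε` are in `L²`. -/
theorem hasDerivAt_integral_quad (hU : IsOpen U) (hB : ContDiffOn ℝ 2 B U) (hK : IsCompact K)
    (hKU : K ⊆ U) (hy : AEMeasurable y ν) (hyK : ∀ᵐ x ∂ν, y x ∈ K) (he : MemLp e 2 ν)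
    (hη : AEMeasurable η ν) (hηm : ∀ᵐ x ∂ν, ‖η x‖ ≤ m) (hε : MemLp ε 2 ν) :
    (∀ᶠ τ : ℝ in 𝓝 0, Integrable
      (fun x => B (y x + τ • η x) (e x + τ • ε x) (e x + τ • ε x)) ν) ∧
    HasDerivAt (fun τ : ℝ => ∫ x, B (y x + τ • η x) (e x + τ • ε x) (e x + τ • ε x) ∂ν)
      (∫ x, quadDeriv B (y x) (e x) (η x) (ε x) ∂ν) 0 := by
  obtain ⟨K', hK', hK'U, hev⟩ := exists_isCompact_eventually_mem hU hK hKU m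
  obtain ⟨c, hc⟩ := exists_C2Bound hU hB hK' hK'U
  have hint : ∀ τ : ℝ, (∀ y η : Y, y ∈ K → ‖η‖ ≤ m → y + τ • η ∈ K') → Integrable
      (fun x => B (y x + τ • η x) (e x + τ • ε x) (e x + τ • ε x)) ν := by
    intro τ hτ
    refine integrable_quad hU hB hK' hK'U (hy.add (hη.const_smul τ)) ?_ (he.add (hε.const_smul τ))
    filter_upwards [hyK, hηm] with x h1 h2 using hτ _ _ h1 h2
  refine ⟨hev.mono hint, ?_⟩
  have hs : {τ : ℝ | (∀ y η : Y, y ∈ K → ‖η‖ ≤ m → y + τ • η ∈ K') ∧ |τ| ≤ 1} ∈ 𝓝 (0 : ℝ) := by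
    refine hev.and ?_
    filter_upwards [Metric.closedBall_mem_nhds (0 : ℝ) one_pos] with τ hτ
    simpa using hτ
  have key := hasDerivAt_integral_of_dominated_loc_of_deriv_le (μ := ν) (𝕜 := ℝ) (x₀ := (0 : ℝ))
    (F := fun τ x => B (y x + τ • η x) (e x + τ • ε x) (e x + τ • ε x))
    (F' := fun τ x => quadDeriv B (y x + τ • η x) (e x + τ • ε x) (η x) (ε x))
    (bound := fun x => c * ((m + 2) * (‖e x‖ + ‖ε x‖) ^ 2)) hs
    (hev.mono fun τ hτ => (hint τ hτ).aestronglyMeasurable) (hint 0 hev.self_of_nhds)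
    ?_ ?_ ?_ ?_
  · simpa using key.2
  · have := aestronglyMeasurable_quadDeriv hU hB hy (hyK.mono fun x hx => hKU hx) he.1 hη hε.1
    simpa using this
  · filter_upwards [hyK, hηm] with x h1 h2 τ hτ
    have hK1 := hc _ (hτ.1 _ _ h1 h2)
    have hc0 : 0 ≤ c := (norm_nonneg _).trans hK1.1
    have hm0 : 0 ≤ m := (norm_nonneg _).trans h2
    refine (abs_quadDeriv_le hK1.1 hK1.2.1 _ h2 _).trans (mul_le_mul_of_nonneg_left ?_ hc0)
    have h3 := norm_add_smul_le hτ.2 (e x) (ε x)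
    have h4 : ‖e x + τ • ε x‖ ^ 2 ≤ (‖e x‖ + ‖ε x‖) ^ 2 := by gcongr
    have h5 : ‖e x + τ • ε x‖ * ‖ε x‖ ≤ (‖e x‖ + ‖ε x‖) * (‖e x‖ + ‖ε x‖) :=
      mul_le_mul h3 (by linarith [norm_nonneg (e x)]) (norm_nonneg _) (by positivity)
    nlinarith [mul_le_mul_of_nonneg_left h4 hm0]
  · exact (((he.norm.add hε.norm).integrable_sq.const_mul (m + 2)).const_mul c)
  · filter_upwards [hyK, hηm] with x h1 h2 τ hτ
    exact hasDerivAt_quad hU hB (hK'U (hτ.1 _ _ h1 h2))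

/-- The same domination one order higher: every term of the second derivative is quadratic in `(e,
ε, ε')`, with coefficients controlled by `c`, `m` and `m'`. -/
theorem hasDerivAt_integral_quadDeriv (hU : IsOpen U) (hB : ContDiffOn ℝ 2 B U)
    (hK : IsCompact K) (hKU : K ⊆ U) (hy : AEMeasurable y ν) (hyK : ∀ᵐ x ∂ν, y x ∈ K)
    (he : MemLp e 2 ν) (hη : AEMeasurable η ν) (hηm : ∀ᵐ x ∂ν, ‖η x‖ ≤ m) (hε : MemLp ε 2 ν)
    (hη' : AEMeasurable η' ν) (hηm' : ∀ᵐ x ∂ν, ‖η' x‖ ≤ m') (hε' : MemLp ε' 2 ν) :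
    HasDerivAt (fun τ : ℝ => ∫ x, quadDeriv B (y x + τ • η' x) (e x + τ • ε' x) (η x) (ε x) ∂ν)
      (∫ x, quadDeriv₂ B (y x) (e x) (η x) (ε x) (η' x) (ε' x) ∂ν) 0 := by
  obtain ⟨K', hK', hK'U, hev⟩ := exists_isCompact_eventually_mem hU hK hKU m'
  obtain ⟨c, hc⟩ := exists_C2Bound hU hB hK' hK'U
  have hs : {τ : ℝ | (∀ y η : Y, y ∈ K → ‖η‖ ≤ m' → y + τ • η ∈ K') ∧ |τ| ≤ 1} ∈ 𝓝 (0 : ℝ) := by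
    refine hev.and ?_
    filter_upwards [Metric.closedBall_mem_nhds (0 : ℝ) one_pos] with τ hτ
    simpa using hτ
  have hmeas : ∀ τ : ℝ, (∀ y η : Y, y ∈ K → ‖η‖ ≤ m' → y + τ • η ∈ K') → AEStronglyMeasurable
      (fun x => quadDeriv B (y x + τ • η' x) (e x + τ • ε' x) (η x) (ε x)) ν := by
    intro τ hτ
    refine aestronglyMeasurable_quadDeriv hU hB (hy.add (hη'.const_smul τ)) ?_
      (he.1.add (hε'.1.const_smul τ)) hη hε.1
    filter_upwards [hyK, hηm'] with x h1 h2 using hK'U (hτ _ _ h1 h2)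
  have key := hasDerivAt_integral_of_dominated_loc_of_deriv_le (μ := ν) (𝕜 := ℝ) (x₀ := (0 : ℝ))
    (F := fun τ x => quadDeriv B (y x + τ • η' x) (e x + τ • ε' x) (η x) (ε x))
    (F' := fun τ x => quadDeriv₂ B (y x + τ • η' x) (e x + τ • ε' x) (η x) (ε x) (η' x) (ε' x))
    (bound := fun x => c * ((m * m' + 2 * m + 2 * m' + 2) * (‖e x‖ + ‖ε x‖ + ‖ε' x‖) ^ 2)) hs
    (hev.mono hmeas) ?_ ?_ ?_ ?_ ?_
  · simpa using key.2
  · refine (((he.norm.add hε.norm).integrable_sq.const_mul (m + 2)).const_mul c).mono'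
      (hmeas 0 hev.self_of_nhds) ?_
    filter_upwards [hyK, hηm, hηm'] with x h1 h2 h2'
    have hK1 := hc _ (hev.self_of_nhds _ _ h1 h2')
    rw [zero_smul, add_zero] at hK1
    have hc0 : 0 ≤ c := (norm_nonneg _).trans hK1.1
    have hm0 : 0 ≤ m := (norm_nonneg _).trans h2
    rw [zero_smul, zero_smul, add_zero, add_zero]
    refine (abs_quadDeriv_le hK1.1 hK1.2.1 _ h2 _).trans (mul_le_mul_of_nonneg_left ?_ hc0)
    have := norm_nonneg (e x)
    have := norm_nonneg (ε x)
    simp only [Pi.add_apply]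
    have : ‖e x‖ ^ 2 ≤ (‖e x‖ + ‖ε x‖) ^ 2 := by gcongr; linarith
    nlinarith [mul_le_mul_of_nonneg_left this hm0]
  · have := aestronglyMeasurable_quadDeriv₂ hU hB hy (hyK.mono fun x hx => hKU hx) he.1 hη hε.1
      hη' hε'.1
    simpa using this
  · filter_upwards [hyK, hηm, hηm'] with x h1 h2 h2' τ hτ
    have hK1 := hc _ (hτ.1 _ _ h1 h2')
    have hc0 : 0 ≤ c := (norm_nonneg _).trans hK1.1
    have hm0 : 0 ≤ m := (norm_nonneg _).trans h2
    have hm0' : 0 ≤ m' := (norm_nonneg _).trans h2'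
    refine (abs_quadDeriv₂_le hK1.1 hK1.2.1 hK1.2.2 _ h2 h2' _ _).trans
      (mul_le_mul_of_nonneg_left ?_ hc0)
    have n1 := norm_nonneg (e x)
    have n2 := norm_nonneg (ε x)
    have n3 := norm_nonneg (ε' x)
    set S := ‖e x‖ + ‖ε x‖ + ‖ε' x‖ with hS
    have h3 : ‖e x + τ • ε' x‖ ≤ S := (norm_add_smul_le hτ.2 (e x) (ε' x)).trans (by linarith)
    have a1 : ‖e x + τ • ε' x‖ ^ 2 ≤ S ^ 2 := by gcongr
    have a2 : ‖e x + τ • ε' x‖ * ‖ε' x‖ ≤ S ^ 2 := by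
      rw [sq]; exact mul_le_mul h3 (by linarith) n3 (by linarith)
    have a3 : ‖e x + τ • ε' x‖ * ‖ε x‖ ≤ S ^ 2 := by
      rw [sq]; exact mul_le_mul h3 (by linarith) n2 (by linarith)
    have a4 : ‖ε x‖ * ‖ε' x‖ ≤ S ^ 2 := by
      rw [sq]; exact mul_le_mul (by linarith) (by linarith) n3 (by linarith)
    have b1 := mul_le_mul_of_nonneg_left a1 (mul_nonneg hm0 hm0')
    have b2 := mul_le_mul_of_nonneg_left a2 hm0
    have b3 := mul_le_mul_of_nonneg_left a3 hm0'
    linarith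
  · exact ((((he.norm.add hε.norm).add hε'.norm).integrable_sq.const_mul _).const_mul c)
  · filter_upwards [hyK, hηm'] with x h1 h2 τ hτ
    exact hasDerivAt_quadDeriv hU hB (hK'U (hτ.1 _ _ h1 h2))

end QuadraticIntegralVariation

/-! ### Averages of the derivative, jets and defects. -/

section Average

variable {E : Type*} [NormedAddCommGroup E] [NormedSpace ℝ E]

/-- The average of the derivative of `f` between `u` and `u + v`. -/
noncomputable def avg (f : ℝ → E) (u v : ℝ) : E := ∫ θ in (0 : ℝ)..1, deriv f (u + θ * v)

theorem avg_zero [CompleteSpace E] (f : ℝ → E) (u : ℝ) : avg f u 0 = deriv f u := by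
  simp [avg]

variable {f h : ℝ → E}

theorem continuous_deriv_comp_segment (hf : ContDiff ℝ 1 f) (u v : ℝ) :
    Continuous fun θ : ℝ => deriv f (u + θ * v) :=
  (hf.continuous_deriv le_rfl).comp (by fun_prop)

/-- The fundamental theorem of calculus along `θ ↦ u + θ v`. It splits a chord into its parameter
step and a factor with a limit, `deriv f u`, as `v → 0`. -/
theorem smul_avg [CompleteSpace E] (hf : ContDiff ℝ 1 f) (u v : ℝ) :
    v • avg f u v = f (u + v) - f u := by
  have h1 : ∀ θ ∈ uIcc (0 : ℝ) 1, HasDerivAt (fun θ : ℝ => f (u + θ * v))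
      (v • deriv f (u + θ * v)) θ := by
    intro θ _
    have hl : HasDerivAt (fun θ : ℝ => u + θ * v) v θ := by
      simpa using ((hasDerivAt_id θ).mul_const v).const_add u
    exact ((hf.differentiable one_ne_zero) (u + θ * v)).hasDerivAt.scomp θ hl
  have h2 := intervalIntegral.integral_eq_sub_of_hasDerivAt h1
    (((continuous_deriv_comp_segment hf u v).const_smul v).intervalIntegrable _ _)
  rw [intervalIntegral.integral_smul] at h2
  simpa [avg] using h2

theorem continuous_avg (hf : ContDiff ℝ 1 f) : Continuous fun x : ℝ × ℝ => avg f x.1 x.2 := by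
  unfold avg
  refine intervalIntegral.continuous_parametric_intervalIntegral_of_continuous' ?_ _ _
  exact (hf.continuous_deriv le_rfl).comp (by fun_prop)

theorem norm_avg_le {M : ℝ} (hM : ∀ u, ‖deriv f u‖ ≤ M) (u v : ℝ) : ‖avg f u v‖ ≤ M := by
  have := intervalIntegral.norm_integral_le_of_norm_le_const (a := (0 : ℝ)) (b := 1)
    (f := fun θ => deriv f (u + θ * v)) (C := M) fun θ _ => hM _
  simpa [avg] using this

theorem deriv_add_smul (hf : ContDiff ℝ 1 f) (hh : ContDiff ℝ 1 h) (τ u : ℝ) :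
    deriv (f + τ • h) u = deriv f u + τ • deriv h u := by
  have h1 := hf.differentiable one_ne_zero u
  have h2 := hh.differentiable one_ne_zero u
  rw [deriv_add h1 (h2.const_smul τ), deriv_const_smul_field]

theorem avg_add_smul (hf : ContDiff ℝ 1 f) (hh : ContDiff ℝ 1 h) (τ u v : ℝ) :
    avg (f + τ • h) u v = avg f u v + τ • avg h u v := by
  unfold avg
  rw [← intervalIntegral.integral_smul, ← intervalIntegral.integral_add
    (g := fun θ => τ • deriv h (u + θ * v))
    ((continuous_deriv_comp_segment hf u v).intervalIntegrable _ _)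
    (((continuous_deriv_comp_segment hh u v).const_smul τ).intervalIntegrable _ _)]
  simp_rw [deriv_add_smul hf hh]

theorem periodic_deriv (hf : Function.Periodic f 1) : Function.Periodic (deriv f) 1 := by
  intro u
  rw [← deriv_comp_add_const]
  congr 1
  exact funext hf

/-- The representative of `t` modulo `1` of smallest modulus. -/
noncomputable def circRep (t : ℝ) : ℝ := t - round t

theorem abs_circRep (t : ℝ) : |circRep t| = ‖(t : UnitAddCircle)‖ := UnitAddCircle.norm_eq.symm

theorem measurable_circRep : Measurable circRep := by
  unfold circRep
  simp_rw [round_eq]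
  exact measurable_id.sub (measurable_from_top.comp
    (Int.measurable_floor.comp (measurable_id.add_const _)))

/-- The chord from `u + w` to `u + v` can thus be taken with the step of modulus at most `1/2`,
whose modulus is the distance on the circle; this makes its average accessible to the bilipschitz
bound. -/
theorem periodic_apply_add_circRep {α : Type*} {f : ℝ → α} (hf : Function.Periodic f 1) (u v w : ℝ) :
    f (u + w + circRep (v - w)) = f (u + v) := by
  have := hf.sub_zsmul_eq (x := u + v) (round (v - w))
  rw [← this]
  congr 1
  simp [circRep]; ring

/-- The first-order data of the curve `f` at the triple `(u, u + v, u + w)`. -/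
noncomputable def jet (f : ℝ → E) (x : ℝ × ℝ × ℝ) : Fin 6 → E :=
  ![avg f x.1 x.2.1, avg f x.1 x.2.2, avg f (x.1 + x.2.2) (circRep (x.2.1 - x.2.2)),
    deriv f x.1, deriv f (x.1 + x.2.1), deriv f (x.1 + x.2.2)]

/-- The difference of the two averages of the derivative of `f` issuing from `u`. -/
noncomputable def defect (f : ℝ → E) (x : ℝ × ℝ × ℝ) : E := avg f x.1 x.2.2 - avg f x.1 x.2.1

/-- Linearity in the curve turns the variation of `γ` along `h` into motion of the jet, and likewise
of the defect, along a straight line. -/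
theorem jet_add_smul (hf : ContDiff ℝ 1 f) (hh : ContDiff ℝ 1 h) (τ : ℝ) (x : ℝ × ℝ × ℝ) :
    jet (f + τ • h) x = jet f x + τ • jet h x := by
  simp only [jet, avg_add_smul hf hh, deriv_add_smul hf hh]
  ext i; fin_cases i <;> rfl

theorem defect_add_smul (hf : ContDiff ℝ 1 f) (hh : ContDiff ℝ 1 h) (τ : ℝ) (x : ℝ × ℝ × ℝ) :
    defect (f + τ • h) x = defect f x + τ • defect h x := by
  simp only [defect, avg_add_smul hf hh]
  module

theorem norm_jet_le {M : ℝ} (hM : ∀ u, ‖deriv f u‖ ≤ M) (x : ℝ × ℝ × ℝ) : ‖jet f x‖ ≤ M := by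
  have hM0 : 0 ≤ M := (norm_nonneg _).trans (hM 0)
  rw [pi_norm_le_iff_of_nonneg hM0]
  intro i
  fin_cases i
  · exact norm_avg_le hM _ _
  · exact norm_avg_le hM _ _
  · exact norm_avg_le hM _ _
  · exact hM _
  · exact hM _
  · exact hM _

theorem measurable_jet [MeasurableSpace E] [BorelSpace E] (hf : ContDiff ℝ 1 f) :
    Measurable (jet f) := by
  have hd := (hf.continuous_deriv le_rfl).measurable
  have ha := (continuous_avg hf).measurable
  rw [measurable_pi_iff]
  intro i
  fin_cases i
  · exact ha.comp (measurable_fst.prodMk measurable_snd.fst)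
  · exact ha.comp (measurable_fst.prodMk measurable_snd.snd)
  · exact ha.comp ((measurable_fst.add measurable_snd.snd).prodMk
      (measurable_circRep.comp (measurable_snd.fst.sub measurable_snd.snd)))
  · exact hd.comp measurable_fst
  · exact hd.comp (measurable_fst.add measurable_snd.fst)
  · exact hd.comp (measurable_fst.add measurable_snd.snd)

theorem continuous_defect (hf : ContDiff ℝ 1 f) : Continuous (defect f) := by
  have ha := continuous_avg hf
  exact (ha.comp (f := fun x : ℝ × ℝ × ℝ => (x.1, x.2.2)) (by fun_prop)).sub
    (ha.comp (f := fun x : ℝ × ℝ × ℝ => (x.1, x.2.1)) (by fun_prop))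

end Average

/-! ### The integrand as kernel times quadratic form. -/

section Form

variable {n : ℕ}

theorem wedge_add_right (a b c : EuclideanSpace ℝ (Fin n)) :
    wedge a (b + c) = wedge a b + wedge a c := by
  ext ij; simp [wedge]; ring

theorem wedge_smul_right (a b : EuclideanSpace ℝ (Fin n)) (r : ℝ) :
    wedge a (r • b) = r • wedge a b := by
  ext ij; simp [wedge]; ring

theorem wedge_comm_neg (a b : EuclideanSpace ℝ (Fin n)) : wedge b a = -wedge a b := by
  ext ij; simp [wedge]; ring

theorem wedge_smul_left (a b : EuclideanSpace ℝ (Fin n)) (r : ℝ) :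
    wedge (r • a) b = r • wedge a b := by
  ext ij; simp [wedge]; ring

/-- This is the cancellation behind the whole proof: it replaces the second average in the wedge by
the difference of the two averages. -/
theorem wedge_sub_self (a b : EuclideanSpace ℝ (Fin n)) : wedge a (b - a) = wedge a b := by
  ext ij; simp [wedge]; ring

theorem contDiff_wedge_left (b : EuclideanSpace ℝ (Fin n)) {k : WithTop ℕ∞} :
    ContDiff ℝ k fun a : EuclideanSpace ℝ (Fin n) => wedge a b := by
  rw [contDiff_euclidean]
  intro ij
  simp only [wedge]
  fun_prop

theorem continuous_wedge :
    Continuous fun x : EuclideanSpace ℝ (Fin n) × EuclideanSpace ℝ (Fin n) => wedge x.1 x.2 := by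
  unfold wedge
  fun_prop

/-- The scalar factor of the integrand of the energy. -/
noncomputable def mengerFactor (p : ℝ) (y : Fin 6 → EuclideanSpace ℝ (Fin n)) : ℝ :=
  ‖y 3‖ * ‖y 4‖ * ‖y 5‖ * (‖y 0‖ * ‖y 1‖ * ‖y 2‖) ^ (-p)

/-- The integrand of the energy as a quadratic form in the defect, depending on the first-order
data of the curve. -/
noncomputable def mengerForm (p : ℝ) (y : Fin 6 → EuclideanSpace ℝ (Fin n)) :
    EuclideanSpace ℝ (Fin n) →L[ℝ] EuclideanSpace ℝ (Fin n) →L[ℝ] ℝ :=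
  LinearMap.toContinuousBilinearMap (LinearMap.mk₂ ℝ
    (fun e e' => mengerFactor p y * inner ℝ (wedge (y 0) e) (wedge (y 0) e'))
    (fun a b c => by simp only [wedge_add_right, inner_add_left]; ring)
    (fun r a b => by simp only [wedge_smul_right, real_inner_smul_left, smul_eq_mul]; ring)
    (fun a b c => by simp only [wedge_add_right, inner_add_right]; ring)
    (fun r a b => by simp only [wedge_smul_right, real_inner_smul_right, smul_eq_mul]; ring))

theorem mengerForm_apply (p : ℝ) (y : Fin 6 → EuclideanSpace ℝ (Fin n))
    (e e' : EuclideanSpace ℝ (Fin n)) :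
    mengerForm p y e e' = mengerFactor p y * inner ℝ (wedge (y 0) e) (wedge (y 0) e') := rfl

theorem mengerForm_self (p : ℝ) (y : Fin 6 → EuclideanSpace ℝ (Fin n))
    (e : EuclideanSpace ℝ (Fin n)) :
    mengerForm p y e e = mengerFactor p y * ‖wedge (y 0) e‖ ^ 2 := by
  rw [mengerForm_apply, real_inner_self_eq_norm_sq]

theorem mengerForm_self_nonneg (p : ℝ) (y : Fin 6 → EuclideanSpace ℝ (Fin n))
    (e : EuclideanSpace ℝ (Fin n)) : 0 ≤ mengerForm p y e e := by
  rw [mengerForm_self, mengerFactor]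
  positivity

/-- First-order data without vanishing entry. -/
def regularSet (n : ℕ) : Set (Fin 6 → EuclideanSpace ℝ (Fin n)) := {y | ∀ i, y i ≠ 0}

theorem isOpen_regularSet : IsOpen (regularSet n) := by
  have : regularSet n = ⋂ i : Fin 6, {y | y i ≠ 0} := by ext; simp [regularSet]
  rw [this]
  exact isOpen_iInter_of_finite fun i => isOpen_ne_fun (continuous_apply i) continuous_const

theorem contDiffOn_mengerForm (p : ℝ) : ContDiffOn ℝ 2 (mengerForm (n := n) p) (regularSet n) := by
  rw [contDiffOn_clm_apply]
  intro e
  rw [contDiffOn_clm_apply]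
  intro e'
  simp only [mengerForm_apply]
  intro y hy
  refine ContDiffAt.contDiffWithinAt ?_
  have hn : ∀ i, ContDiffAt ℝ 2 (fun y : Fin 6 → EuclideanSpace ℝ (Fin n) => ‖y i‖) y := fun i =>
    (contDiff_apply ℝ _ i).contDiffAt.norm ℝ (hy i)
  have hp : ∀ i, 0 < ‖y i‖ := fun i => norm_pos_iff.2 (hy i)
  have hw : ∀ e, ContDiffAt ℝ 2
      (fun y : Fin 6 → EuclideanSpace ℝ (Fin n) => wedge (y 0) e) y := fun e =>
    ((contDiff_wedge_left e).comp (contDiff_apply ℝ _ 0)).contDiffAt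
  refine ContDiffAt.mul ?_ ((hw e).inner ℝ (hw e'))
  unfold mengerFactor
  refine (((hn 3).mul (hn 4)).mul (hn 5)).mul ?_
  refine ContDiffAt.rpow_const_of_ne (((hn 0).mul (hn 1)).mul (hn 2)) ?_
  have := hp 0; have := hp 1; have := hp 2
  positivity

theorem measurable_mengerForm_self {X : Type*} [MeasurableSpace X] (p : ℝ)
    {y : X → Fin 6 → EuclideanSpace ℝ (Fin n)} {e : X → EuclideanSpace ℝ (Fin n)}
    (hy : Measurable y) (he : Measurable e) :
    Measurable fun x => mengerForm p (y x) (e x) (e x) := by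
  simp only [mengerForm_self, mengerFactor]
  have h0 : ∀ i : Fin 6, Measurable fun x => y x i := fun i => (measurable_pi_apply i).comp hy
  refine Measurable.mul ?_ ?_
  · exact (((h0 3).norm.mul (h0 4).norm).mul (h0 5).norm).mul
      ((((h0 0).norm.mul (h0 1).norm).mul (h0 2).norm).pow_const _)
  · exact (continuous_wedge.measurable.comp ((h0 0).prodMk he)).norm.pow_const 2

/-- The kernel of the energy. -/
noncomputable def kern (p v w : ℝ) : ℝ :=
  |v| ^ (2 - p) * |w| ^ (2 - p) * |circRep (v - w)| ^ (-p)

theorem kern_nonneg (p v w : ℝ) : 0 ≤ kern p v w := by unfold kern; positivity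

/-- At `v = 0` both sides vanish; `p ≠ 2` excludes the convention `0 ^ 0 = 1`. -/
theorem abs_rpow_two_sub {p : ℝ} (hp : p ≠ 2) (v : ℝ) : |v| ^ (2 - p) = v ^ 2 * |v| ^ (-p) := by
  rcases eq_or_ne v 0 with rfl | hv
  · simp [Real.zero_rpow (sub_ne_zero.2 hp.symm)]
  · rw [sub_eq_add_neg, Real.rpow_add (abs_pos.2 hv), Real.rpow_two, sq_abs]

/-- The integrand of the energy. -/
noncomputable def mengerIntegrand (p : ℝ) (γ : ℝ → EuclideanSpace ℝ (Fin n)) (x y z : ℝ) : ℝ :=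
  ‖deriv γ x‖ * ‖deriv γ y‖ * ‖deriv γ z‖ * invR p 2 (γ x) (γ y) (γ z)

/-- The squared wedge contributes `v² w²` and the denominator contributes the three steps to the
power `-p`. With division by zero and powers of zero as defined, the identity also holds at
degenerate triples. -/
theorem mengerIntegrand_eq {p : ℝ} (hp : p ≠ 2) {γ : ℝ → EuclideanSpace ℝ (Fin n)}
    (hγ : ContDiff ℝ 1 γ) (hper : Function.Periodic γ 1) (u v w : ℝ) :
    mengerIntegrand p γ u (u + v) (u + w) =
      kern p v w * mengerForm p (jet γ (u, v, w)) (defect γ (u, v, w)) (defect γ (u, v, w)) := by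
  have ha := smul_avg hγ u v
  have hb := smul_avg hγ u w
  have hd := smul_avg hγ (u + w) (circRep (v - w))
  rw [periodic_apply_add_circRep hper] at hd
  rw [mengerForm_self, mengerFactor, kern, abs_rpow_two_sub hp, abs_rpow_two_sub hp,
    mengerIntegrand, invR, ← ha, ← hb, ← hd]
  simp only [jet, defect, Matrix.cons_val]
  rw [wedge_sub_self, wedge_smul_left, wedge_smul_right, norm_smul, norm_smul, norm_smul,
    norm_smul, norm_smul, Real.rpow_two, div_eq_mul_inv, ← Real.rpow_neg (by positivity)]
  simp only [Real.norm_eq_abs]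
  rw [show |v| * ‖avg γ u v‖ * (|w| * ‖avg γ u w‖) *
      (|circRep (v - w)| * ‖avg γ (u + w) (circRep (v - w))‖) =
      |v| * |w| * |circRep (v - w)| *
        (‖avg γ u v‖ * ‖avg γ u w‖ * ‖avg γ (u + w) (circRep (v - w))‖) by ring,
    Real.mul_rpow (by positivity) (by positivity),
    Real.mul_rpow (x := |v| * |w|) (by positivity) (by positivity),
    Real.mul_rpow (x := |v|) (by positivity) (by positivity), mul_pow, mul_pow, sq_abs, sq_abs]
  ring

/-- The wedge is twice the oriented area of the triangle and only changes sign when vertices are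
exchanged. Together with the swap of the last two points this gives invariance under all
permutations. -/
theorem invR_swap_left (p q : ℝ) (x y z : EuclideanSpace ℝ (Fin n)) :
    invR p q y x z = invR p q x y z := by
  unfold invR
  have h1 : wedge (x - y) (z - y) = -wedge (y - x) (z - x) := by
    ext ij; simp [wedge]; ring
  rw [h1, norm_neg, norm_sub_rev x y, norm_sub_rev z y, norm_sub_rev x z]
  congr 2
  ring

theorem invR_swap_right (p q : ℝ) (x y z : EuclideanSpace ℝ (Fin n)) :
    invR p q x z y = invR p q x y z := by
  unfold invR
  rw [wedge_comm_neg, norm_neg, norm_sub_rev z y, mul_comm ‖z - x‖]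

theorem mengerIntegrand_swap_left (p : ℝ) (γ : ℝ → EuclideanSpace ℝ (Fin n)) (x y z : ℝ) :
    mengerIntegrand p γ y x z = mengerIntegrand p γ x y z := by
  unfold mengerIntegrand
  rw [invR_swap_left, mul_comm ‖deriv γ y‖]

theorem mengerIntegrand_swap_right (p : ℝ) (γ : ℝ → EuclideanSpace ℝ (Fin n)) (x y z : ℝ) :
    mengerIntegrand p γ x z y = mengerIntegrand p γ x y z := by
  unfold mengerIntegrand
  rw [invR_swap_right]
  ring

theorem measurable_mengerIntegrand (p : ℝ) {γ : ℝ → EuclideanSpace ℝ (Fin n)}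
    (hγ : ContDiff ℝ 1 γ) :
    Measurable fun x : ℝ × ℝ × ℝ => mengerIntegrand p γ x.1 x.2.1 x.2.2 := by
  have hd := (hγ.continuous_deriv le_rfl).measurable
  have hc := hγ.continuous.measurable
  unfold mengerIntegrand invR
  have g1 : Measurable fun x : ℝ × ℝ × ℝ => γ x.1 := hc.comp measurable_fst
  have g2 : Measurable fun x : ℝ × ℝ × ℝ => γ x.2.1 := hc.comp measurable_snd.fst
  have g3 : Measurable fun x : ℝ × ℝ × ℝ => γ x.2.2 := hc.comp measurable_snd.snd
  refine Measurable.mul ?_ (Measurable.div ?_ ?_)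
  · exact ((hd.comp measurable_fst).norm.mul (hd.comp measurable_snd.fst).norm).mul
      (hd.comp measurable_snd.snd).norm
  · exact (continuous_wedge.measurable.comp ((g2.sub g1).prodMk (g3.sub g1))).norm.pow_const _
  · exact (((g2.sub g1).norm.mul (g3.sub g1).norm).mul (g2.sub g3).norm).pow_const _

end Form

/-! ### Reduction to triples whose first point is opposite to the longest side. -/

section Symmetrization

/-- The number of times a triple counts when the triples are reordered such that the first entry
is opposite to the longest side `a`, the other sides being `b` and `c`. -/
noncomputable def multiplicity (a b c : ℝ) : ℝ≥0∞ :=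
  (if c ≤ a ∧ b ≤ a then 1 else 0) + (if c ≤ a ∧ b < a then 1 else 0) +
    (if b < a ∧ c < a then 1 else 0)

theorem multiplicity_le (a b c : ℝ) : multiplicity a b c ≤ 3 := by
  have h : ∀ (P : Prop) [Decidable P], (if P then (1 : ℝ≥0∞) else 0) ≤ 1 := fun P _ => by
    split_ifs <;> simp
  unfold multiplicity
  calc _ ≤ (1 : ℝ≥0∞) + 1 + 1 := by gcongr <;> exact h _
    _ = 3 := by norm_num

theorem le_of_multiplicity_ne_zero {a b c : ℝ} (h : multiplicity a b c ≠ 0) : b ≤ a ∧ c ≤ a := by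
  by_contra hcon
  apply h
  unfold multiplicity
  rw [if_neg, if_neg, if_neg]
  · simp
  · rintro ⟨h1, h2⟩; exact hcon ⟨h1.le, h2.le⟩
  · rintro ⟨h1, h2⟩; exact hcon ⟨h2.le, h1⟩
  · rintro ⟨h1, h2⟩; exact hcon ⟨h2, h1⟩

theorem measurable_multiplicity {α : Type*} [MeasurableSpace α] {a b c : α → ℝ}
    (ha : Measurable a) (hb : Measurable b) (hc : Measurable c) :
    Measurable fun x => multiplicity (a x) (b x) (c x) := by
  classical
  unfold multiplicity
  refine Measurable.add (Measurable.add ?_ ?_) ?_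
  · exact Measurable.ite ((measurableSet_le hc ha).inter (measurableSet_le hb ha))
      measurable_const measurable_const
  · exact Measurable.ite ((measurableSet_le hc ha).inter (measurableSet_lt hb ha))
      measurable_const measurable_const
  · exact Measurable.ite ((measurableSet_lt hb ha).inter (measurableSet_lt hc ha))
      measurable_const measurable_const

/-- The mixture of weak and strict inequalities breaks ties, so that exactly one of the three sides
is selected as longest. -/
theorem ite_longest_add (a b c : ℝ) : (if c ≤ a ∧ b ≤ a then (1 : ℝ≥0∞) else 0) +
    (if c ≤ b ∧ a < b then 1 else 0) + (if b < c ∧ a < c then 1 else 0) = 1 := by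
  by_cases h1 : c ≤ a ∧ b ≤ a
  · rw [if_pos h1, if_neg (by grind), if_neg (by grind), add_zero, add_zero]
  · by_cases h2 : c ≤ b ∧ a < b
    · rw [if_neg h1, if_pos h2, if_neg (by grind), add_zero, zero_add]
    · rw [if_neg h1, if_neg h2, if_pos (by grind), zero_add, zero_add]

variable {μ : Measure ℝ} [SFinite μ]

theorem lintegral₃_swap_left {Ψ : ℝ → ℝ → ℝ → ℝ≥0∞}
    (hΨ : Measurable fun x : ℝ × ℝ × ℝ => Ψ x.1 x.2.1 x.2.2) :
    ∫⁻ x, ∫⁻ y, ∫⁻ z, Ψ x y z ∂μ ∂μ ∂μ = ∫⁻ x, ∫⁻ y, ∫⁻ z, Ψ y x z ∂μ ∂μ ∂μ := by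
  rw [lintegral_lintegral_swap]
  have : Measurable fun x : (ℝ × ℝ) × ℝ => Ψ x.1.1 x.1.2 x.2 :=
    hΨ.comp (measurable_fst.fst.prodMk (measurable_fst.snd.prodMk measurable_snd))
  exact this.lintegral_prod_right'.aemeasurable

theorem lintegral₃_swap_right {Ψ : ℝ → ℝ → ℝ → ℝ≥0∞}
    (hΨ : Measurable fun x : ℝ × ℝ × ℝ => Ψ x.1 x.2.1 x.2.2) :
    ∫⁻ x, ∫⁻ y, ∫⁻ z, Ψ x y z ∂μ ∂μ ∂μ = ∫⁻ x, ∫⁻ y, ∫⁻ z, Ψ x z y ∂μ ∂μ ∂μ := by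
  refine lintegral_congr fun x => ?_
  rw [lintegral_lintegral_swap]
  exact (hΨ.comp (measurable_const.prodMk measurable_id)).aemeasurable

theorem lintegral₃_swap_outer {Ψ : ℝ → ℝ → ℝ → ℝ≥0∞}
    (hΨ : Measurable fun x : ℝ × ℝ × ℝ => Ψ x.1 x.2.1 x.2.2) :
    ∫⁻ x, ∫⁻ y, ∫⁻ z, Ψ x y z ∂μ ∂μ ∂μ = ∫⁻ x, ∫⁻ y, ∫⁻ z, Ψ z y x ∂μ ∂μ ∂μ := by
  rw [lintegral₃_swap_left hΨ, lintegral₃_swap_right (Ψ := fun x y z => Ψ y x z),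
    lintegral₃_swap_left (Ψ := fun x y z => Ψ z x y)]
  · exact hΨ.comp (measurable_snd.snd.prodMk (measurable_fst.prodMk measurable_snd.fst))
  · exact hΨ.comp (measurable_snd.fst.prodMk (measurable_fst.prodMk measurable_snd.snd))

theorem lintegral₃_add {Ψ₁ Ψ₂ : ℝ → ℝ → ℝ → ℝ≥0∞}
    (h₁ : Measurable fun x : ℝ × ℝ × ℝ => Ψ₁ x.1 x.2.1 x.2.2) :
    ∫⁻ x, ∫⁻ y, ∫⁻ z, (Ψ₁ x y z + Ψ₂ x y z) ∂μ ∂μ ∂μ =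
      ∫⁻ x, ∫⁻ y, ∫⁻ z, Ψ₁ x y z ∂μ ∂μ ∂μ + ∫⁻ x, ∫⁻ y, ∫⁻ z, Ψ₂ x y z ∂μ ∂μ ∂μ := by
  have m1 : Measurable fun x : (ℝ × ℝ) × ℝ => Ψ₁ x.1.1 x.1.2 x.2 :=
    h₁.comp (measurable_fst.fst.prodMk (measurable_fst.snd.prodMk measurable_snd))
  have m2 : Measurable fun x : ℝ × ℝ => ∫⁻ z, Ψ₁ x.1 x.2 z ∂μ := m1.lintegral_prod_right'
  have m3 : Measurable fun x : ℝ => ∫⁻ y, ∫⁻ z, Ψ₁ x y z ∂μ ∂μ := m2.lintegral_prod_right'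
  rw [← lintegral_add_left m3]
  refine lintegral_congr fun x => ?_
  have m4 : Measurable fun y => ∫⁻ z, Ψ₁ x y z ∂μ :=
    m2.comp (measurable_const.prodMk measurable_id)
  rw [← lintegral_add_left m4]
  refine lintegral_congr fun y => ?_
  rw [← lintegral_add_left]
  exact m1.comp (g := fun x : (ℝ × ℝ) × ℝ => Ψ₁ x.1.1 x.1.2 x.2) (f := fun z => ((x, y), z))
    (measurable_const.prodMk measurable_id)

/-- The distance of the classes modulo `1`. -/
noncomputable def circDist (x y : ℝ) : ℝ := ‖((x - y : ℝ) : UnitAddCircle)‖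

theorem circDist_comm (x y : ℝ) : circDist x y = circDist y x := by
  unfold circDist
  rw [← norm_neg, ← AddCircle.coe_neg, neg_sub]

theorem measurable_circDist {α : Type*} [MeasurableSpace α] {a b : α → ℝ} (ha : Measurable a)
    (hb : Measurable b) : Measurable fun x => circDist (a x) (b x) := by
  unfold circDist
  simp_rw [← abs_circRep]
  exact (measurable_circRep.comp (ha.sub hb)).abs

/-- The integral of a symmetric function reduces to the triples whose first entry is opposite to
the longest side. -/
theorem lintegral₃_eq_multiplicity {Φ : ℝ → ℝ → ℝ → ℝ≥0∞}
    (hΦ : Measurable fun x : ℝ × ℝ × ℝ => Φ x.1 x.2.1 x.2.2)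
    (hleft : ∀ x y z, Φ y x z = Φ x y z) (hright : ∀ x y z, Φ x z y = Φ x y z) :
    ∫⁻ x, ∫⁻ y, ∫⁻ z, Φ x y z ∂μ ∂μ ∂μ = ∫⁻ x, ∫⁻ y, ∫⁻ z,
      Φ x y z * multiplicity (circDist y z) (circDist x z) (circDist x y) ∂μ ∂μ ∂μ := by
  classical
  have d12 : Measurable fun x : ℝ × ℝ × ℝ => circDist x.1 x.2.1 :=
    measurable_circDist measurable_fst measurable_snd.fst
  have d13 : Measurable fun x : ℝ × ℝ × ℝ => circDist x.1 x.2.2 :=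
    measurable_circDist measurable_fst measurable_snd.snd
  have d23 : Measurable fun x : ℝ × ℝ × ℝ => circDist x.2.1 x.2.2 :=
    measurable_circDist measurable_snd.fst measurable_snd.snd
  set Φ₁ : ℝ → ℝ → ℝ → ℝ≥0∞ := fun x y z => Φ x y z *
    (if circDist x y ≤ circDist y z ∧ circDist x z ≤ circDist y z then 1 else 0) with hΦ₁
  set Φ₂ : ℝ → ℝ → ℝ → ℝ≥0∞ := fun x y z => Φ x y z *
    (if circDist x y ≤ circDist x z ∧ circDist y z < circDist x z then 1 else 0) with hΦ₂
  set Φ₃ : ℝ → ℝ → ℝ → ℝ≥0∞ := fun x y z => Φ x y z *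
    (if circDist x z < circDist x y ∧ circDist y z < circDist x y then 1 else 0) with hΦ₃
  have m1 : Measurable fun x : ℝ × ℝ × ℝ => Φ₁ x.1 x.2.1 x.2.2 :=
    hΦ.mul (Measurable.ite ((measurableSet_le d12 d23).inter (measurableSet_le d13 d23))
      measurable_const measurable_const)
  have m2 : Measurable fun x : ℝ × ℝ × ℝ => Φ₂ x.1 x.2.1 x.2.2 :=
    hΦ.mul (Measurable.ite ((measurableSet_le d12 d13).inter (measurableSet_lt d23 d13))
      measurable_const measurable_const)
  have m3 : Measurable fun x : ℝ × ℝ × ℝ => Φ₃ x.1 x.2.1 x.2.2 :=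
    hΦ.mul (Measurable.ite ((measurableSet_lt d13 d12).inter (measurableSet_lt d23 d12))
      measurable_const measurable_const)
  have hsum : ∀ x y z, Φ x y z = Φ₁ x y z + Φ₂ x y z + Φ₃ x y z := by
    intro x y z
    simp only [hΦ₁, hΦ₂, hΦ₃]
    rw [← mul_add, ← mul_add]
    rw [ite_longest_add, mul_one]
  -- On the support of `Φ₂` the longest side is opposite to `y`, on that of `Φ₃` opposite to `z`;
  -- exchanging that variable with `x` puts the opposite vertex first, and by symmetry `Φ` itself
  -- does not change.
  have hmult : ∀ x y z, Φ x y z * multiplicity (circDist y z) (circDist x z) (circDist x y) =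
      Φ₁ x y z + Φ₂ y x z + Φ₃ z y x := by
    intro x y z
    simp only [hΦ₁, hΦ₂, hΦ₃]
    have e1 : Φ z y x = Φ x y z := by rw [hleft, hright, hleft]
    rw [hleft x y z, e1, ← mul_add, ← mul_add, multiplicity, circDist_comm y x, circDist_comm z x,
      circDist_comm z y]
  have m2' : Measurable fun x : ℝ × ℝ × ℝ => Φ₂ x.2.1 x.1 x.2.2 :=
    m2.comp (measurable_snd.fst.prodMk (measurable_fst.prodMk measurable_snd.snd))
  simp_rw [hmult]
  rw [lintegral₃_add (Ψ₁ := fun x y z => Φ₁ x y z + Φ₂ y x z) (Ψ₂ := fun x y z => Φ₃ z y x)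
    (m1.add m2'), lintegral₃_add (Ψ₁ := Φ₁) (Ψ₂ := fun x y z => Φ₂ y x z) m1,
    ← lintegral₃_swap_left m2, ← lintegral₃_swap_outer m3, ← lintegral₃_add m1,
    ← lintegral₃_add (Ψ₁ := fun x y z => Φ₁ x y z + Φ₂ x y z) (m1.add m2)]
  simp_rw [← hsum]

/-- The interval of representatives of smallest modulus. -/
noncomputable def centralMeasure : Measure ℝ := volume.restrict (Ioc (-(1 / 2)) (1 / 2))

noncomputable instance : IsFiniteMeasure centralMeasure := by
  unfold centralMeasure; infer_instance

theorem lintegral_Ioc_eq_centralMeasure {H : ℝ → ℝ≥0∞} (hH : Function.Periodic H 1) (u : ℝ) :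
    ∫⁻ x in Ioc (0 : ℝ) 1, H x = ∫⁻ v, H (u + v) ∂centralMeasure := by
  have h1 := lintegral_Ioc_periodic hH 0 (u - 1 / 2)
  rw [zero_add] at h1
  rw [h1, centralMeasure, ← lintegral_indicator measurableSet_Ioc,
    ← lintegral_indicator measurableSet_Ioc, ← lintegral_add_left_eq_self _ u]
  refine lintegral_congr fun v => ?_
  by_cases hv : v ∈ Ioc (-(1 / 2) : ℝ) (1 / 2)
  · rw [indicator_of_mem hv, indicator_of_mem]
    exact ⟨by linarith [hv.1], by linarith [hv.2]⟩
  · rw [indicator_of_notMem hv, indicator_of_notMem]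
    intro h
    exact hv ⟨by linarith [h.1], by linarith [h.2]⟩

end Symmetrization

/-! ### The energy as an integral over a fixed measure. -/

section Representation

variable {n : ℕ}

/-- The underlying measure of the parameter domain of triples `(u, u + v, u + w)`. -/
noncomputable def baseMeasure : Measure (ℝ × ℝ × ℝ) :=
  (volume.restrict (Ioc (0 : ℝ) 1)).prod (centralMeasure.prod centralMeasure)

/-- The weight of the parameter domain. -/
noncomputable def mengerDensity (p : ℝ) (x : ℝ × ℝ × ℝ) : ℝ≥0∞ :=
  multiplicity (circDist x.2.1 x.2.2) (circDist 0 x.2.2) (circDist 0 x.2.1) *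
    ENNReal.ofReal (kern p x.2.1 x.2.2)

theorem measurable_mengerDensity (p : ℝ) : Measurable (mengerDensity p) := by
  refine Measurable.mul (measurable_multiplicity ?_ ?_ ?_) (Measurable.ennreal_ofReal ?_)
  · exact measurable_circDist measurable_snd.fst measurable_snd.snd
  · exact measurable_circDist measurable_const measurable_snd.snd
  · exact measurable_circDist measurable_const measurable_snd.fst
  · unfold kern
    refine (((measurable_snd.fst.abs).pow_const _).mul ((measurable_snd.snd.abs).pow_const _)).mul
      (Measurable.pow_const (Measurable.abs ?_) _)
    exact measurable_circRep.comp (measurable_snd.fst.sub measurable_snd.snd)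

/-- The measure with respect to which the energy is the integral of `mengerForm`. -/
noncomputable def mengerMeasure (p : ℝ) : Measure (ℝ × ℝ × ℝ) :=
  baseMeasure.withDensity (mengerDensity p)

theorem circDist_add_left (u x y : ℝ) : circDist (u + x) (u + y) = circDist x y := by
  unfold circDist
  rw [add_sub_add_left_eq_sub]

theorem measurable_mengerForm_jet (p : ℝ) {γ : ℝ → EuclideanSpace ℝ (Fin n)}
    (hγ : ContDiff ℝ 1 γ) :
    Measurable fun x => mengerForm p (jet γ x) (defect γ x) (defect γ x) :=
  measurable_mengerForm_self p (measurable_jet hγ) (continuous_defect hγ).measurable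

theorem circDist_add_one_left (x y : ℝ) : circDist (x + 1) y = circDist x y := by
  unfold circDist
  rw [show x + 1 - y = x - y + 1 by ring, AddCircle.coe_add, AddCircle.coe_period, add_zero]

theorem circDist_add_one_right (x y : ℝ) : circDist x (y + 1) = circDist x y := by
  rw [circDist_comm, circDist_add_one_left, circDist_comm]

/-- The energy as an integral of a quadratic form in the defect. -/
theorem menger_eq_lintegral {p : ℝ} (hp : p ≠ 2) {γ : ℝ → EuclideanSpace ℝ (Fin n)}
    (hγ : ContDiff ℝ 1 γ) (hper : Function.Periodic γ 1) :
    menger p 2 γ = ∫⁻ x, ENNReal.ofReal (mengerForm p (jet γ x) (defect γ x) (defect γ x))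
      ∂mengerMeasure p := by
  have hdper := periodic_deriv hper
  have hm := (measurable_mengerIntegrand p hγ).ennreal_ofReal
  have mF := (measurable_mengerForm_jet p hγ).ennreal_ofReal
  set I : ℝ → ℝ → ℝ → ℝ≥0∞ := fun x y z => ENNReal.ofReal (mengerIntegrand p γ x y z) *
    multiplicity (circDist y z) (circDist x z) (circDist x y) with hI
  have step1 : menger p 2 γ = ∫⁻ x in Ioc (0 : ℝ) 1, ∫⁻ y in Ioc (0 : ℝ) 1,
      ∫⁻ z in Ioc (0 : ℝ) 1, ENNReal.ofReal (mengerIntegrand p γ x y z) := by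
    change ∫⁻ x : ℝ × ℝ × ℝ in Ioc (0 : ℝ) 1 ×ˢ Ioc (0 : ℝ) 1 ×ˢ Ioc (0 : ℝ) 1,
      ENNReal.ofReal (mengerIntegrand p γ x.1 x.2.1 x.2.2) = _
    rw [Measure.volume_eq_prod, Measure.volume_eq_prod, ← Measure.prod_restrict,
      ← Measure.prod_restrict]
    rw [lintegral_prod _ hm.aemeasurable]
    refine lintegral_congr fun x => ?_
    rw [lintegral_prod]
    exact (hm.comp (measurable_const.prodMk measurable_id)).aemeasurable
  -- Periodicity in `y` and `z` separately allows both period intervals to be centred at `u`, so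
  -- that `v` and `w` become representatives of smallest modulus.
  have perz : ∀ x y, Function.Periodic (fun z => I x y z) 1 := by
    intro x y z
    simp only [hI, mengerIntegrand, hdper z, hper z, circDist_add_one_right]
  have pery : ∀ x z, Function.Periodic (fun y => I x y z) 1 := by
    intro x z y
    simp only [hI, mengerIntegrand, hdper y, hper y, circDist_add_one_right, circDist_add_one_left]
  have step2 : menger p 2 γ = ∫⁻ u in Ioc (0 : ℝ) 1, ∫⁻ v, ∫⁻ w, I u (u + v) (u + w)
      ∂centralMeasure ∂centralMeasure := by
    rw [step1, lintegral₃_eq_multiplicity hm]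
    · refine lintegral_congr fun u => ?_
      have : Function.Periodic (fun y => ∫⁻ z in Ioc (0 : ℝ) 1, I u y z) 1 := fun y =>
        lintegral_congr fun z => pery u z y
      rw [lintegral_Ioc_eq_centralMeasure this u]
      refine lintegral_congr fun v => ?_
      exact lintegral_Ioc_eq_centralMeasure (perz u (u + v)) u
    · intro x y z; rw [mengerIntegrand_swap_left]
    · intro x y z; rw [mengerIntegrand_swap_right]
  rw [step2, mengerMeasure, lintegral_withDensity_eq_lintegral_mul _ (measurable_mengerDensity p)
    mF]
  have mG : Measurable (mengerDensity p * fun x =>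
      ENNReal.ofReal (mengerForm p (jet γ x) (defect γ x) (defect γ x))) :=
    (measurable_mengerDensity p).mul mF
  rw [baseMeasure, lintegral_prod _ mG.aemeasurable]
  refine lintegral_congr fun u => ?_
  rw [lintegral_prod]
  · refine lintegral_congr fun v => lintegral_congr fun w => ?_
    simp only [hI, Pi.mul_apply, mengerDensity]
    rw [mengerIntegrand_eq hp hγ hper, ENNReal.ofReal_mul (kern_nonneg _ _ _),
      circDist_add_left]
    have : ∀ t, circDist u (u + t) = circDist 0 t := fun t => by
      rw [← circDist_add_left u 0 t, add_zero]
    rw [this, this]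
    ring
  · exact (mG.comp (measurable_const.prodMk measurable_id)).aemeasurable

end Representation

/-! ### The kernel after symmetrization. -/

section Kernel

theorem lintegral_comp_abs (h : ℝ → ℝ≥0∞) :
    ∫⁻ w, h |w| = 2 * ∫⁻ w in Ioi (0 : ℝ), h w := by
  have h1 : ∫⁻ w in Ioi (0 : ℝ), h |w| = ∫⁻ w in Ioi (0 : ℝ), h w :=
    setLIntegral_congr_fun measurableSet_Ioi fun w hw => by
      simp only [abs_of_pos (show (0 : ℝ) < w from hw)]
  have h2 : ∫⁻ w in Iio (0 : ℝ), h |w| = ∫⁻ w in Ioi (0 : ℝ), h |w| := by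
    rw [← lintegral_indicator measurableSet_Iio, ← lintegral_indicator measurableSet_Ioi,
      ← lintegral_neg_eq_self]
    refine lintegral_congr fun w => ?_
    by_cases hw : 0 < w
    · rw [indicator_of_mem (show -w ∈ Iio (0 : ℝ) by simpa using hw),
        indicator_of_mem (show w ∈ Ioi (0 : ℝ) from hw), abs_neg]
    · rw [indicator_of_notMem (show -w ∉ Iio (0 : ℝ) by simpa using hw),
        indicator_of_notMem (show w ∉ Ioi (0 : ℝ) from hw)]
  rw [← lintegral_add_compl _ measurableSet_Ioi (A := Ioi (0 : ℝ)), compl_Ioi,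
    setLIntegral_congr Iio_ae_eq_Iic.symm, h2, h1, two_mul]

/-- The majorant of the kernel. -/
noncomputable def majorant (p v w : ℝ) : ℝ :=
  |v| ^ (2 - p) * |w| ^ (2 - p) * (max |v| |w|) ^ (-p)

theorem majorant_comm (p v w : ℝ) : majorant p v w = majorant p w v := by
  unfold majorant; rw [max_comm, mul_comm (|v| ^ (2 - p))]

theorem measurable_majorant (p : ℝ) : Measurable fun x : ℝ × ℝ => majorant p x.1 x.2 := by
  unfold majorant
  exact ((measurable_fst.abs.pow_const _).mul (measurable_snd.abs.pow_const _)).mul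
    ((measurable_fst.abs.max measurable_snd.abs).pow_const _)

theorem circDist_zero_left {v : ℝ} (hv : |v| ≤ 1 / 2) : circDist 0 v = |v| := by
  unfold circDist
  rw [zero_sub, AddCircle.coe_neg, norm_neg]
  exact (AddCircle.norm_coe_eq_abs_iff 1 one_ne_zero).2 (by simpa using hv)

/-- Where the multiplicity is nonzero, the third side `|circRep (v - w)|` is at least `max |v| |w|`,
and the exponent `-p` is negative. The factor `3` bounds the multiplicity. -/
theorem mengerDensity_le {p : ℝ} (hp : 2 < p) (u : ℝ) {v w : ℝ} (hv : |v| ≤ 1 / 2)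
    (hw : |w| ≤ 1 / 2) :
    mengerDensity p (u, v, w) ≤ 3 * ENNReal.ofReal (majorant p v w) := by
  unfold mengerDensity
  simp only [circDist_zero_left hv, circDist_zero_left hw]
  by_cases hm : multiplicity (circDist v w) |w| |v| = 0
  · rw [hm, zero_mul]; exact zero_le
  · obtain ⟨h1, h2⟩ := le_of_multiplicity_ne_zero hm
    refine mul_le_mul' (multiplicity_le _ _ _) (ENNReal.ofReal_le_ofReal ?_)
    unfold kern majorant
    rcases eq_or_ne v 0 with rfl | hv0
    · simp [Real.zero_rpow (show 2 - p ≠ 0 by linarith)]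
    · refine mul_le_mul_of_nonneg_left ?_ (by positivity)
      refine Real.rpow_le_rpow_of_nonpos (lt_max_of_lt_left (abs_pos.2 hv0)) ?_ (by linarith)
      rw [abs_circRep]
      exact max_le h2 h1

/-- Split at `|w| = |v|`. The inner part is `|v|^(2-2p) ∫ w^(2-p)`, convergent at `0` since `p < 3`;
the outer part is `|v|^(2-p) ∫ w^(2-2p)`, convergent at infinity since `2p > 3`. Both scale like
`|v|^(5-3p)`, and `5 - 3p = -(1 + 2s)` for `s = 3p/2 - 3`. The leading `2` counts the signs of `w`.
-/
theorem lintegral_majorant_le {p : ℝ} (hp : 2 < p) (hp3 : p < 3) (v : ℝ) :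
    ∫⁻ w, ENNReal.ofReal (majorant p v w) ≤
      ENNReal.ofReal (2 * (1 / (3 - p) + 1 / (2 * p - 3))) *
        ENNReal.ofReal (|v| ^ (-(1 + 2 * (3 / 2 * p - 3)))) := by
  rcases eq_or_ne v 0 with rfl | hv
  · simp [majorant, Real.zero_rpow (show 2 - p ≠ 0 by linarith)]
  set r := |v| with hr
  have hr0 : 0 < r := abs_pos.2 hv
  set h : ℝ → ℝ≥0∞ := fun w => ENNReal.ofReal (r ^ (2 - p) * w ^ (2 - p) * (max r w) ^ (-p))
    with hh
  have e1 : ∫⁻ w, ENNReal.ofReal (majorant p v w) = 2 * ∫⁻ w in Ioi (0 : ℝ), h w := by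
    rw [← lintegral_comp_abs h]; rfl
  have e2 : ∫⁻ w in Ioc 0 r, h w = ENNReal.ofReal (r ^ (2 - p) * r ^ (-p) *
      (r ^ (3 - p) / (3 - p))) := by
    have i1 : IntegrableOn (fun w : ℝ => w ^ (2 - p)) (Ioc 0 r) := by
      rw [← intervalIntegrable_iff_integrableOn_Ioc_of_le hr0.le]
      exact intervalIntegral.intervalIntegrable_rpow' (by linarith)
    have i2 : ∫ w in Ioc 0 r, w ^ (2 - p) = r ^ (3 - p) / (3 - p) := by
      rw [← intervalIntegral.integral_of_le hr0.le, integral_rpow (Or.inl (by linarith)),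
        show 2 - p + 1 = 3 - p by ring, Real.zero_rpow (by linarith), sub_zero]
    rw [← i2, ← integral_const_mul, ofReal_integral_eq_lintegral_ofReal (i1.const_mul _)]
    · refine setLIntegral_congr_fun measurableSet_Ioc fun w hw => ?_
      simp only [hh, max_eq_left hw.2]
      congr 1; ring
    · filter_upwards [ae_restrict_mem measurableSet_Ioc] with w hw
      have := hw.1
      simp only [Pi.zero_apply]
      positivity
  have e3 : ∫⁻ w in Ioi r, h w = ENNReal.ofReal (r ^ (2 - p) * (r ^ (3 - 2 * p) / (2 * p - 3))) := by
    have i1 : IntegrableOn (fun w : ℝ => w ^ (2 - 2 * p)) (Ioi r) :=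
      integrableOn_Ioi_rpow_of_lt (by linarith) hr0
    have i2 : ∫ w in Ioi r, w ^ (2 - 2 * p) = r ^ (3 - 2 * p) / (2 * p - 3) := by
      rw [integral_Ioi_rpow_of_lt (by linarith) hr0, show 2 - 2 * p + 1 = 3 - 2 * p by ring,
        neg_div, ← div_neg, neg_sub]
    rw [← i2, ← integral_const_mul, ofReal_integral_eq_lintegral_ofReal (i1.const_mul _)]
    · refine setLIntegral_congr_fun measurableSet_Ioi fun w hw => ?_
      have hw0 : 0 < w := hr0.trans hw
      simp only [hh, max_eq_right (le_of_lt (show r < w from hw))]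
      rw [mul_assoc, ← Real.rpow_add hw0]
      congr 3; ring
    · filter_upwards [ae_restrict_mem measurableSet_Ioi] with w hw
      have : 0 < w := hr0.trans hw
      simp only [Pi.zero_apply]
      positivity
  have hc1 : 0 < 3 - p := by linarith
  have hc2 : 0 < 2 * p - 3 := by linarith
  rw [e1, ← Ioc_union_Ioi_eq_Ioi hr0.le, lintegral_union measurableSet_Ioi
    (Ioc_disjoint_Ioi le_rfl), e2, e3, ← ENNReal.ofReal_add (by positivity) (by positivity),
    ← ENNReal.ofReal_mul (by positivity),
    show (2 : ℝ≥0∞) = ENNReal.ofReal 2 by simp, ← ENNReal.ofReal_mul (by norm_num)]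
  refine ENNReal.ofReal_le_ofReal (le_of_eq ?_)
  have p1 : r ^ (2 - p) * r ^ (-p) * r ^ (3 - p) = r ^ (-(1 + 2 * (3 / 2 * p - 3))) := by
    rw [← Real.rpow_add hr0, ← Real.rpow_add hr0]; congr 1; ring
  have p2 : r ^ (2 - p) * r ^ (3 - 2 * p) = r ^ (-(1 + 2 * (3 / 2 * p - 3))) := by
    rw [← Real.rpow_add hr0]; congr 1; ring
  rw [← mul_div_assoc, ← mul_div_assoc, p1, p2]
  ring

end Kernel

/-! ### The weighted `L²` bound of the defect. -/

section Energy

variable {E : Type*} [NormedAddCommGroup E]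

theorem lintegral_centralMeasure_eq_slobodeckij_sq (s : ℝ) (g : ℝ → E) :
    ∫⁻ u in Ioc (0 : ℝ) 1, ∫⁻ v, ENNReal.ofReal (|v| ^ (-(1 + 2 * s))) *
      ‖g (u + v) - g u‖ₑ ^ 2 ∂centralMeasure = slobodeckij s g ^ 2 := by
  rw [slobodeckij_sq]
  refine lintegral_congr fun u => ?_
  rw [centralMeasure, ← restrict_Ioo_eq_restrict_Ioc]
  refine lintegral_congr fun v => ?_
  rw [← ofReal_norm, ← ENNReal.ofReal_pow (norm_nonneg _), ← ENNReal.ofReal_mul (by positivity),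
    Real.rpow_neg (abs_nonneg _), div_eq_inv_mul]

theorem enorm_sub_sq_le (a b c : E) : ‖b - a‖ₑ ^ 2 ≤ 2 * ‖a - c‖ₑ ^ 2 + 2 * ‖b - c‖ₑ ^ 2 := by
  simp only [← ofReal_norm]
  rw [← ENNReal.ofReal_pow (norm_nonneg _), ← ENNReal.ofReal_pow (norm_nonneg _),
    ← ENNReal.ofReal_pow (norm_nonneg _), show (2 : ℝ≥0∞) = ENNReal.ofReal 2 by simp,
    ← ENNReal.ofReal_mul (by norm_num), ← ENNReal.ofReal_mul (by norm_num),
    ← ENNReal.ofReal_add (by positivity) (by positivity)]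
  refine ENNReal.ofReal_le_ofReal ?_
  have h : ‖b - a‖ ≤ ‖b - c‖ + ‖a - c‖ := by
    have := norm_sub_le (b - c) (a - c)
    simpa using this
  nlinarith [norm_nonneg (b - a), sq_nonneg (‖b - c‖ - ‖a - c‖)]

variable [NormedSpace ℝ E] {f : ℝ → E}

theorem lintegral_comp_mul_left {θ : ℝ} (hθ : 0 < θ) {G : ℝ → ℝ≥0∞} (hG : Measurable G) :
    ∫⁻ v, G (θ * v) = ENNReal.ofReal θ⁻¹ * ∫⁻ v, G v := by
  rw [← lintegral_map hG (measurable_const_mul θ), Real.map_volume_mul_left hθ.ne',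
    lintegral_smul_measure, abs_of_pos (inv_pos.2 hθ), smul_eq_mul]

/-- Rescaling the increments decreases the seminorm. -/
theorem lintegral_increment_rescale_le {s : ℝ} (hs : 0 ≤ s) (hf : ContDiff ℝ 1 f) (u : ℝ) {θ : ℝ}
    (hθ : θ ∈ Ioc (0 : ℝ) 1) :
    ∫⁻ v, ENNReal.ofReal (|v| ^ (-(1 + 2 * s))) * ‖deriv f (u + θ * v) - deriv f u‖ₑ ^ 2
      ∂centralMeasure ≤
    ∫⁻ v, ENNReal.ofReal (|v| ^ (-(1 + 2 * s))) * ‖deriv f (u + v) - deriv f u‖ₑ ^ 2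
      ∂centralMeasure := by
  have hd := hf.continuous_deriv le_rfl
  obtain ⟨h0, h1⟩ := hθ
  set G : ℝ → ℝ≥0∞ := (Ioc (-(1 / 2) : ℝ) (1 / 2)).indicator fun v =>
    ENNReal.ofReal (|v| ^ (-(1 + 2 * s))) * ‖deriv f (u + v) - deriv f u‖ₑ ^ 2 with hG
  have hGm : Measurable G := by
    refine Measurable.indicator ?_ measurableSet_Ioc
    refine Measurable.mul (measurable_id.abs.pow_const _).ennreal_ofReal ?_
    have : Continuous fun v => deriv f (u + v) - deriv f u := by fun_prop
    exact this.enorm.measurable.pow_const 2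
  have key : ∫⁻ v, ENNReal.ofReal (|v| ^ (-(1 + 2 * s))) *
      ‖deriv f (u + θ * v) - deriv f u‖ₑ ^ 2 ∂centralMeasure ≤
      ∫⁻ v, ENNReal.ofReal (θ ^ (1 + 2 * s)) * G (θ * v) := by
    rw [centralMeasure, ← lintegral_indicator measurableSet_Ioc]
    refine lintegral_mono fun v => ?_
    by_cases hv : v ∈ Ioc (-(1 / 2) : ℝ) (1 / 2)
    · have hθv : θ * v ∈ Ioc (-(1 / 2) : ℝ) (1 / 2) := by
        constructor
        · rcases le_or_gt 0 v with h | h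
          · nlinarith
          · nlinarith [hv.1]
        · rcases le_or_gt 0 v with h | h
          · nlinarith [hv.2]
          · nlinarith
      simp only [hG]
      rw [indicator_of_mem hv, indicator_of_mem hθv, ← mul_assoc,
        ← ENNReal.ofReal_mul (by positivity)]
      refine mul_le_mul_left (ENNReal.ofReal_le_ofReal (le_of_eq ?_)) _
      rw [abs_mul, abs_of_pos h0, Real.mul_rpow h0.le (abs_nonneg _), ← mul_assoc,
        ← Real.rpow_add h0, add_neg_cancel, Real.rpow_zero, one_mul]
    · rw [indicator_of_notMem hv]; exact zero_le
  refine key.trans ?_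
  rw [lintegral_const_mul' _ _ ENNReal.ofReal_ne_top, lintegral_comp_mul_left h0 hGm,
    ← mul_assoc, ← ENNReal.ofReal_mul (by positivity), hG,
    lintegral_indicator measurableSet_Ioc, centralMeasure]
  -- The weight gives `θ^(1+2s)` and the change of variables `θ⁻¹`, so the remaining factor is
  -- `θ^(2s) ≤ 1`.
  refine mul_le_of_le_one_left zero_le ?_
  rw [ENNReal.ofReal_le_one, Real.rpow_add h0, Real.rpow_one, mul_comm, ← mul_assoc,
    inv_mul_cancel₀ h0.ne', one_mul]
  exact Real.rpow_le_one h0.le h1 (by linarith)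

theorem enorm_avg_sub_deriv_sq_le [CompleteSpace E] (hf : ContDiff ℝ 1 f) (u v : ℝ) :
    ‖avg f u v - deriv f u‖ₑ ^ 2 ≤
      ∫⁻ θ in Ioc (0 : ℝ) 1, ‖deriv f (u + θ * v) - deriv f u‖ₑ ^ 2 := by
  have hc := continuous_deriv_comp_segment hf u v
  have e : avg f u v - deriv f u = ∫ θ in Ioc (0 : ℝ) 1, (deriv f (u + θ * v) - deriv f u) := by
    rw [← intervalIntegral.integral_of_le zero_le_one, intervalIntegral.integral_sub
      (hc.intervalIntegrable _ _) (by simp)]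
    simp [avg]
  have h1 : ‖avg f u v - deriv f u‖ₑ ≤
      ∫⁻ θ in Ioc (0 : ℝ) 1, ‖deriv f (u + θ * v) - deriv f u‖ₑ := by
    rw [e]; exact enorm_integral_le_lintegral_enorm _
  refine (pow_le_pow_left' h1 2).trans ((sq_lintegral_le ?_).trans ?_)
  · exact (hc.sub continuous_const).enorm.measurable.aemeasurable
  · simp

/-- Jensen's inequality moves the square inside the average over `θ`; after Fubini each `θ` is
handled by rescaling the increments. -/
theorem lintegral_avg_sub_deriv_le [CompleteSpace E] {s : ℝ} (hs : 0 ≤ s) (hf : ContDiff ℝ 1 f)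
    (u : ℝ) :
    ∫⁻ v, ENNReal.ofReal (|v| ^ (-(1 + 2 * s))) * ‖avg f u v - deriv f u‖ₑ ^ 2 ∂centralMeasure ≤
      ∫⁻ v, ENNReal.ofReal (|v| ^ (-(1 + 2 * s))) * ‖deriv f (u + v) - deriv f u‖ₑ ^ 2
        ∂centralMeasure := by
  have hd := hf.continuous_deriv le_rfl
  set H := ∫⁻ v, ENNReal.ofReal (|v| ^ (-(1 + 2 * s))) * ‖deriv f (u + v) - deriv f u‖ₑ ^ 2
        ∂centralMeasure with hH
  calc _ ≤ ∫⁻ v, (∫⁻ θ in Ioc (0 : ℝ) 1, ENNReal.ofReal (|v| ^ (-(1 + 2 * s))) *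
        ‖deriv f (u + θ * v) - deriv f u‖ₑ ^ 2) ∂centralMeasure := by
        refine lintegral_mono fun v => ?_
        rw [lintegral_const_mul' _ _ ENNReal.ofReal_ne_top]
        exact mul_le_mul_right (enorm_avg_sub_deriv_sq_le hf u v) _
    _ = ∫⁻ θ in Ioc (0 : ℝ) 1, ∫⁻ v, ENNReal.ofReal (|v| ^ (-(1 + 2 * s))) *
        ‖deriv f (u + θ * v) - deriv f u‖ₑ ^ 2 ∂centralMeasure := by
        refine lintegral_lintegral_swap (Measurable.aemeasurable ?_)
        have : Continuous fun x : ℝ × ℝ => deriv f (u + x.2 * x.1) - deriv f u := by fun_prop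
        exact (measurable_fst.abs.pow_const _).ennreal_ofReal.mul
          (this.enorm.measurable.pow_const 2)
    _ ≤ ∫⁻ _ in Ioc (0 : ℝ) 1, H :=
        setLIntegral_mono' measurableSet_Ioc fun θ hθ =>
          lintegral_increment_rescale_le hs hf u hθ
    _ = H := by simp

/-- The constant in the bound of the weighted `L²` norm of the defect. -/
noncomputable def defectConst (p : ℝ) : ℝ := 24 * (1 / (3 - p) + 1 / (2 * p - 3))

theorem abs_le_half_of_mem {v : ℝ} (hv : v ∈ Ioc (-(1 / 2) : ℝ) (1 / 2)) : |v| ≤ 1 / 2 :=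
  abs_le.2 ⟨hv.1.le, hv.2⟩

/-- Subtracting `deriv f u` from both averages splits the defect into a function of `v` and the same
function of `w`. The majorant is symmetric, so the two halves agree, and integrating out the idle
variable leaves the Slobodeckij weight. -/
theorem lintegral_defect_sq_le [CompleteSpace E] {p : ℝ} (hp : 2 < p) (hp3 : p < 3)
    (hf : ContDiff ℝ 1 f) :
    ∫⁻ x, ‖defect f x‖ₑ ^ 2 ∂mengerMeasure p ≤
      ENNReal.ofReal (defectConst p) * slobodeckij (3 / 2 * p - 3) (deriv f) ^ 2 := by
  have hd := hf.continuous_deriv le_rfl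
  have ha := continuous_avg hf
  have mdef : Measurable fun x => ‖defect f x‖ₑ ^ 2 :=
    (continuous_defect hf).enorm.measurable.pow_const 2
  have mG : Measurable (mengerDensity p * fun x => ‖defect f x‖ₑ ^ 2) :=
    (measurable_mengerDensity p).mul mdef
  rw [mengerMeasure, lintegral_withDensity_eq_lintegral_mul _ (measurable_mengerDensity p) mdef,
    baseMeasure, lintegral_prod _ mG.aemeasurable,
    ← lintegral_centralMeasure_eq_slobodeckij_sq,
    ← lintegral_const_mul' _ _ ENNReal.ofReal_ne_top]
  refine lintegral_mono fun u => ?_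
  set A : ℝ → ℝ≥0∞ := fun v => ‖avg f u v - deriv f u‖ₑ ^ 2 with hA
  have mA : Measurable A := by
    have : Continuous fun v => avg f u v - deriv f u :=
      (ha.comp (f := fun v => (u, v)) (by fun_prop)).sub continuous_const
    exact this.enorm.measurable.pow_const 2
  set k : ℝ → ℝ → ℝ≥0∞ := fun v w => ENNReal.ofReal (majorant p v w) with hk
  have mk : Measurable fun x : ℝ × ℝ => k x.1 x.2 := (measurable_majorant p).ennreal_ofReal
  have mk1 : ∀ v, Measurable (k v) := fun v => mk.comp (measurable_const.prodMk measurable_id)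
  have hsymm : ∫⁻ v, ∫⁻ w, k v w * A w ∂centralMeasure ∂centralMeasure =
      ∫⁻ v, ∫⁻ w, k v w * A v ∂centralMeasure ∂centralMeasure := by
    rw [lintegral_lintegral_swap]
    · refine lintegral_congr fun v => lintegral_congr fun w => ?_
      simp only [hk, majorant_comm p w v]
    · exact (mk.mul (mA.comp measurable_snd)).aemeasurable
  have hA1 : ∫⁻ v, ∫⁻ w, k v w * A v ∂centralMeasure ∂centralMeasure ≤
      ENNReal.ofReal (2 * (1 / (3 - p) + 1 / (2 * p - 3))) *
        ∫⁻ v, ENNReal.ofReal (|v| ^ (-(1 + 2 * (3 / 2 * p - 3)))) * A v ∂centralMeasure := by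
    rw [← lintegral_const_mul' _ _ ENNReal.ofReal_ne_top]
    refine lintegral_mono fun v => ?_
    rw [lintegral_mul_const _ (mk1 v), ← mul_assoc]
    refine mul_le_mul_left ?_ _
    exact (lintegral_mono' Measure.restrict_le_self le_rfl).trans (lintegral_majorant_le hp hp3 v)
  have m1 : Measurable fun x : ℝ × ℝ => k x.1 x.2 * A x.1 := mk.mul (mA.comp measurable_fst)
  calc _ = ∫⁻ v, ∫⁻ w, mengerDensity p (u, v, w) * ‖defect f (u, v, w)‖ₑ ^ 2
        ∂centralMeasure ∂centralMeasure := by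
        rw [lintegral_prod]
        · rfl
        · exact (mG.comp (measurable_const.prodMk measurable_id)).aemeasurable
    _ ≤ ∫⁻ v, ∫⁻ w, (6 * (k v w * A v) + 6 * (k v w * A w)) ∂centralMeasure ∂centralMeasure := by
        refine setLIntegral_mono' measurableSet_Ioc fun v hv => ?_
        refine setLIntegral_mono' measurableSet_Ioc fun w hw => ?_
        -- The `24` in `defectConst` arises as `3` from the multiplicity, `2` from `(a + b)² ≤ 2a² +
        -- 2b²`, `2` from the two equal halves and `2` from the signs in `lintegral_majorant_le`.
        calc _ ≤ 3 * k v w * (2 * A v + 2 * A w) :=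
              mul_le_mul' (mengerDensity_le hp u (abs_le_half_of_mem hv) (abs_le_half_of_mem hw))
                (enorm_sub_sq_le _ _ _)
          _ = _ := by ring
    _ = 12 * ∫⁻ v, ∫⁻ w, k v w * A v ∂centralMeasure ∂centralMeasure := by
        have e1 : ∀ v, ∫⁻ w, (6 * (k v w * A v) + 6 * (k v w * A w)) ∂centralMeasure =
            6 * ∫⁻ w, k v w * A v ∂centralMeasure + 6 * ∫⁻ w, k v w * A w ∂centralMeasure := by
          intro v
          have m2 : Measurable fun w => 6 * (k v w * A v) := ((mk1 v).mul_const _).const_mul 6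
          rw [lintegral_add_left m2,
            lintegral_const_mul' _ _ (by simp), lintegral_const_mul' _ _ (by simp)]
        simp_rw [e1]
        rw [lintegral_add_left (m1.lintegral_prod_right'.const_mul 6),
          lintegral_const_mul' _ _ (by simp), lintegral_const_mul' _ _ (by simp), hsymm, ← add_mul]
        norm_num
    _ ≤ 12 * (ENNReal.ofReal (2 * (1 / (3 - p) + 1 / (2 * p - 3))) *
        ∫⁻ v, ENNReal.ofReal (|v| ^ (-(1 + 2 * (3 / 2 * p - 3)))) * A v ∂centralMeasure) := by
        gcongr
    _ ≤ ENNReal.ofReal (defectConst p) * _ := by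
        rw [← mul_assoc, show (12 : ℝ≥0∞) = ENNReal.ofReal 12 by simp,
          ← ENNReal.ofReal_mul (by norm_num), defectConst]
        refine mul_le_mul' (ENNReal.ofReal_le_ofReal (le_of_eq (by ring))) ?_
        exact lintegral_avg_sub_deriv_le (by linarith) hf u

end Energy

/-! ### The bilipschitz constant bounds the jet from below. -/

section BiLipschitz

variable {E : Type*} [NormedAddCommGroup E] {γ : ℝ → E}

theorem periodic_apply_fract {α : Type*} {f : ℝ → α} (hf : Function.Periodic f 1) (u : ℝ) :
    f (Int.fract u) = f u := by
  have := hf.sub_zsmul_eq (x := u) ⌊u⌋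
  rwa [zsmul_one] at this

theorem biLip_mul_le (γ : ℝ → E) {u₁ u₂ : ℝ} :
    biLip γ * ‖((u₁ - u₂ : ℝ) : UnitAddCircle)‖ ≤ ‖γ u₁ - γ u₂‖ := by
  by_cases h : (u₁ : UnitAddCircle) = (u₂ : UnitAddCircle)
  · rw [AddCircle.coe_sub, h, sub_self, norm_zero, mul_zero]
    exact norm_nonneg _
  · have hpos : 0 < ‖((u₁ - u₂ : ℝ) : UnitAddCircle)‖ := by
      rw [AddCircle.coe_sub, norm_pos_iff]; exact sub_ne_zero.2 h
    rw [← le_div_iff₀ hpos]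
    refine csInf_le ⟨0, ?_⟩ ⟨u₁, u₂, h, rfl⟩
    rintro r ⟨a, b, -, rfl⟩
    positivity

/-- First-order data whose entries have norms between `b` and `M`. -/
def annulus (E : Type*) [NormedAddCommGroup E] (b M : ℝ) : Set (Fin 6 → E) :=
  {y | ∀ i, b ≤ ‖y i‖ ∧ ‖y i‖ ≤ M}

theorem isCompact_annulus [ProperSpace E] (b M : ℝ) : IsCompact (annulus E b M) := by
  have : annulus E b M = Set.pi univ fun _ => (Metric.closedBall (0 : E) M) ∩ {x | b ≤ ‖x‖} := by
    ext y; simp [annulus, and_comm]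
  rw [this]
  exact isCompact_univ_pi fun _ => (isCompact_closedBall _ _).inter_right
    (isClosed_le continuous_const continuous_norm)

theorem annulus_mono {b b' M M' : ℝ} (hb : b' ≤ b) (hM : M ≤ M') :
    annulus E b M ⊆ annulus E b' M' := fun _ hy i =>
  ⟨hb.trans (hy i).1, (hy i).2.trans hM⟩

theorem abs_circRep_le (t : ℝ) : |circRep t| ≤ 1 / 2 := abs_sub_round t

variable [NormedSpace ℝ E]

theorem periodic_avg (hper : Function.Periodic γ 1) (v : ℝ) :
    Function.Periodic (fun u => avg γ u v) 1 := by
  intro u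
  simp only [avg]
  congr 1
  ext θ
  rw [show u + 1 + θ * v = u + θ * v + 1 by ring, periodic_deriv hper]

variable [CompleteSpace E]

theorem biLip_le_norm_avg (hγ : ContDiff ℝ 1 γ) (u : ℝ) {v : ℝ} (hv0 : v ≠ 0)
    (hv : |v| ≤ 1 / 2) : biLip γ ≤ ‖avg γ u v‖ := by
  have h := biLip_mul_le γ (u₁ := u + v) (u₂ := u)
  rw [add_sub_cancel_left, (AddCircle.norm_coe_eq_abs_iff 1 one_ne_zero).2 (by simpa using hv),
    ← smul_avg hγ, norm_smul, Real.norm_eq_abs, mul_comm] at h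
  exact le_of_mul_le_mul_left h (abs_pos.2 hv0)

/-- The derivative is the limit of the averages as `v → 0`, so it inherits their lower bound. -/
theorem biLip_le_norm_deriv (hγ : ContDiff ℝ 1 γ) (u : ℝ) : biLip γ ≤ ‖deriv γ u‖ := by
  have hc : Continuous fun v => ‖avg γ u v‖ :=
    ((continuous_avg hγ).comp (f := fun v => (u, v)) (by fun_prop)).norm
  have ht : Tendsto (fun v => ‖avg γ u v‖) (𝓝[≠] 0) (𝓝 ‖deriv γ u‖) := by
    have := hc.tendsto 0
    rw [avg_zero] at this
    exact this.mono_left nhdsWithin_le_nhds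
  refine ge_of_tendsto ht ?_
  have h1 : ∀ᶠ v : ℝ in 𝓝[≠] 0, v ∈ Metric.closedBall (0 : ℝ) (1 / 2) :=
    mem_nhdsWithin_of_mem_nhds (Metric.closedBall_mem_nhds _ (by norm_num))
  filter_upwards [h1, self_mem_nhdsWithin] with v hv hv0
  exact biLip_le_norm_avg hγ u hv0 (by simpa using hv)

/-- `avg γ` is continuous and vanishes nowhere on the compact set `[0, 1] × [-1/2, 1/2]`: for `v ≠
0` by injectivity, for `v = 0` by regularity. By periodicity its minimal norm there bounds every
quotient in the infimum. -/
theorem biLip_pos (hγ : ContDiff ℝ 1 γ) (hper : Function.Periodic γ 1)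
    (hinj : InjOn γ (Ico (0 : ℝ) 1)) (hreg : ∀ u, deriv γ u ≠ 0) : 0 < biLip γ := by
  have hne : ∀ u v : ℝ, |v| ≤ 1 / 2 → avg γ u v ≠ 0 := by
    intro u v hv h0
    rcases eq_or_ne v 0 with rfl | hv0
    · rw [avg_zero] at h0; exact hreg u h0
    · have h1 := smul_avg hγ u v
      rw [h0, smul_zero, eq_comm, sub_eq_zero, ← periodic_apply_fract hper (u + v),
        ← periodic_apply_fract hper u] at h1
      have h2 := hinj ⟨Int.fract_nonneg _, Int.fract_lt_one _⟩
        ⟨Int.fract_nonneg _, Int.fract_lt_one _⟩ h1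
      obtain ⟨z, hz⟩ := Int.fract_eq_fract.1 h2
      rw [add_sub_cancel_left] at hz
      rw [hz] at hv hv0
      have hz0 : z ≠ 0 := by rintro rfl; simp at hv0
      have : (1 : ℝ) ≤ |(z : ℝ)| := by exact_mod_cast Int.one_le_abs hz0
      linarith
  have hcomp : IsCompact (Icc (0 : ℝ) 1 ×ˢ Icc (-(1 / 2) : ℝ) (1 / 2)) :=
    isCompact_Icc.prod isCompact_Icc
  obtain ⟨x, hx, hmin⟩ := hcomp.exists_isMinOn ⟨((0 : ℝ), (0 : ℝ)), by constructor <;> norm_num⟩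
    (continuous_avg hγ).norm.continuousOn
  have hm : 0 < ‖avg γ x.1 x.2‖ := norm_pos_iff.2 (hne _ _ (abs_le.2 hx.2))
  refine lt_of_lt_of_le hm (le_csInf ?_ ?_)
  -- The set of quotients must be shown to be nonempty; the points `1/2` and `0` are distinct on the
  -- circle.
  · refine ⟨_, 1 / 2, 0, ?_, rfl⟩
    intro h
    have h1 : ‖((1 / 2 : ℝ) : UnitAddCircle)‖ = |(1 / 2 : ℝ)| :=
      (AddCircle.norm_coe_eq_abs_iff 1 one_ne_zero).2 (by norm_num)
    rw [h] at h1
    norm_num at h1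
  · rintro r ⟨u₁, u₂, hu, rfl⟩
    have hpos : 0 < ‖((u₁ - u₂ : ℝ) : UnitAddCircle)‖ := by
      rw [AddCircle.coe_sub, norm_pos_iff]; exact sub_ne_zero.2 hu
    rw [le_div_iff₀ hpos, ← abs_circRep]
    have e1 := smul_avg hγ u₂ (circRep (u₁ - u₂))
    have e2 : γ (u₂ + circRep (u₁ - u₂)) = γ u₁ := by
      simpa using periodic_apply_add_circRep hper 0 u₁ u₂
    rw [e2] at e1
    rw [← e1, norm_smul, Real.norm_eq_abs, mul_comm]
    refine mul_le_mul_of_nonneg_left ?_ (abs_nonneg _)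
    rw [← periodic_apply_fract (periodic_avg hper (circRep (u₁ - u₂))) u₂]
    exact hmin (a := (Int.fract u₂, circRep (u₁ - u₂)))
      ⟨⟨Int.fract_nonneg _, (Int.fract_lt_one _).le⟩, abs_le.1 (abs_circRep_le _)⟩

theorem annulus_subset_regularSet {n : ℕ} {b M : ℝ} (hb : 0 < b) :
    annulus (EuclideanSpace ℝ (Fin n)) b M ⊆ regularSet n := fun y hy i h => by
  have := (hy i).1
  rw [h, norm_zero] at this
  linarith

/-- Powers of zero with nonzero exponent are zero, so the kernel, and with it the density, vanishes
at degenerate triples; these are null for `mengerMeasure` without further argument. -/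
theorem ae_mengerMeasure {p : ℝ} (hp : 2 < p) :
    ∀ᵐ x ∂mengerMeasure p, (x.2.1 ≠ 0 ∧ |x.2.1| ≤ 1 / 2) ∧ (x.2.2 ≠ 0 ∧ |x.2.2| ≤ 1 / 2) ∧
      circRep (x.2.1 - x.2.2) ≠ 0 := by
  rw [mengerMeasure, ae_withDensity_iff (measurable_mengerDensity p)]
  have h1 : ∀ᵐ x ∂baseMeasure, x ∈ Ioc (0 : ℝ) 1 ×ˢ
      (Ioc (-(1 / 2) : ℝ) (1 / 2) ×ˢ Ioc (-(1 / 2) : ℝ) (1 / 2)) := by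
    rw [baseMeasure, centralMeasure, Measure.prod_restrict, Measure.prod_restrict]
    exact ae_restrict_mem (measurableSet_Ioc.prod (measurableSet_Ioc.prod measurableSet_Ioc))
  filter_upwards [h1] with x hx hd
  have hk : kern p x.2.1 x.2.2 ≠ 0 := by
    intro h0
    exact hd (by rw [mengerDensity, h0, ENNReal.ofReal_zero, mul_zero])
  have h2p : 2 - p ≠ 0 := by linarith
  refine ⟨⟨?_, abs_le_half_of_mem hx.2.1⟩, ⟨?_, abs_le_half_of_mem hx.2.2⟩, ?_⟩
  · intro h0; exact hk (by simp [kern, h0, Real.zero_rpow h2p])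
  · intro h0; exact hk (by simp [kern, h0, Real.zero_rpow h2p])
  · intro h0; exact hk (by simp [kern, h0, Real.zero_rpow (show -p ≠ 0 by linarith)])

theorem jet_mem_annulus {p M : ℝ} (hp : 2 < p) (hγ : ContDiff ℝ 1 γ)
    (hM : ∀ u, ‖deriv γ u‖ ≤ M) : ∀ᵐ x ∂mengerMeasure p, jet γ x ∈ annulus E (biLip γ) M := by
  filter_upwards [ae_mengerMeasure hp] with x hx i
  refine ⟨?_, (norm_le_pi_norm _ i).trans (norm_jet_le hM x)⟩
  fin_cases i
  · exact biLip_le_norm_avg hγ _ hx.1.1 hx.1.2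
  · exact biLip_le_norm_avg hγ _ hx.2.1.1 hx.2.1.2
  · exact biLip_le_norm_avg hγ _ hx.2.2 (abs_circRep_le _)
  · exact biLip_le_norm_deriv hγ _
  · exact biLip_le_norm_deriv hγ _
  · exact biLip_le_norm_deriv hγ _

end BiLipschitz

/-! ### Optimal `C²` bounds and their monotonicity. -/

section Constants

set_option maxSynthPendingDepth 3

variable {Y E : Type*} [NormedAddCommGroup Y] [NormedSpace ℝ Y]
  [NormedAddCommGroup E] [NormedSpace ℝ E]

/-- The least common bound of `B` and its first two derivatives on `K`. -/
noncomputable def c2Sup (B : Y → E →L[ℝ] E →L[ℝ] ℝ) (K : Set Y) : ℝ :=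
  sSup (insert 0 ((fun y => max ‖B y‖ (max ‖fderiv ℝ B y‖ ‖fderiv ℝ (fderiv ℝ B) y‖)) '' K))

variable {B : Y → E →L[ℝ] E →L[ℝ] ℝ} {K K' : Set Y} {c : ℝ}

theorem C2Bound.bddAbove (h : C2Bound B K c) : BddAbove
    (insert 0 ((fun y => max ‖B y‖ (max ‖fderiv ℝ B y‖ ‖fderiv ℝ (fderiv ℝ B) y‖)) '' K)) := by
  refine BddAbove.insert 0 ⟨c, ?_⟩
  rintro _ ⟨y, hy, rfl⟩
  exact max_le (h y hy).1 (max_le (h y hy).2.1 (h y hy).2.2)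

theorem C2Bound.c2Sup (h : C2Bound B K c) : C2Bound B K (c2Sup B K) := by
  intro y hy
  have h1 := le_csSup h.bddAbove (mem_insert_of_mem 0 (mem_image_of_mem _ hy))
  exact ⟨(le_max_left _ _).trans h1, ((le_max_left _ _).trans (le_max_right _ _)).trans h1,
    ((le_max_right _ _).trans (le_max_right _ _)).trans h1⟩

/-- The inserted `0` gives nonnegativity even for empty `K`; it also keeps the set nonempty when
suprema are compared. -/
theorem C2Bound.c2Sup_nonneg (h : C2Bound B K c) : 0 ≤ Menger.c2Sup B K :=
  le_csSup h.bddAbove (mem_insert _ _)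

theorem C2Bound.c2Sup_mono (h : C2Bound B K' c) (hK : K ⊆ K') :
    Menger.c2Sup B K ≤ Menger.c2Sup B K' :=
  csSup_le_csSup h.bddAbove (insert_nonempty _ _) (insert_subset_insert (image_mono hK))

end Constants

/-! ### The variations of the energy. -/

section Variation

variable {n : ℕ}

theorem memLp_defect {p : ℝ} (hp : 2 < p) (hp3 : p < 3) {f : ℝ → EuclideanSpace ℝ (Fin n)}
    (hf : ContDiff ℝ 1 f) (hfin : slobodeckij (3 / 2 * p - 3) (deriv f) ≠ ⊤) :
    MemLp (defect f) 2 (mengerMeasure p) := by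
  refine ⟨(continuous_defect hf).aestronglyMeasurable, ?_⟩
  rw [eLpNorm_lt_top_iff_lintegral_rpow_enorm_lt_top (by norm_num) (by norm_num)]
  have h := lintegral_defect_sq_le hp hp3 hf
  simp only [ENNReal.toReal_ofNat, ENNReal.rpow_two]
  exact h.trans_lt (ENNReal.mul_lt_top ENNReal.ofReal_lt_top (ENNReal.pow_lt_top hfin.lt_top))

theorem defectConst_nonneg {p : ℝ} (hp : 2 < p) (hp3 : p < 3) : 0 ≤ defectConst p := by
  unfold defectConst
  have : 0 < 3 - p := by linarith
  have : 0 < 2 * p - 3 := by linarith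
  positivity

theorem integral_defect_sq_le {p : ℝ} (hp : 2 < p) (hp3 : p < 3)
    {f : ℝ → EuclideanSpace ℝ (Fin n)} (hf : ContDiff ℝ 1 f)
    (hfin : slobodeckij (3 / 2 * p - 3) (deriv f) ≠ ⊤) :
    ∫ x, ‖defect f x‖ ^ 2 ∂mengerMeasure p ≤
      (√(defectConst p) * slobodeckijReal (3 / 2 * p - 3) (deriv f)) ^ 2 := by
  rw [integral_eq_lintegral_of_nonneg_ae (Eventually.of_forall fun x => by positivity)
    (Continuous.aestronglyMeasurable (by have := continuous_defect hf; fun_prop)), mul_pow,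
    Real.sq_sqrt (defectConst_nonneg hp hp3)]
  have h := lintegral_defect_sq_le hp hp3 hf
  have h2 := ENNReal.toReal_mono (ENNReal.mul_ne_top ENNReal.ofReal_ne_top
    (ENNReal.pow_ne_top hfin)) h
  rw [ENNReal.toReal_mul, ENNReal.toReal_ofReal (defectConst_nonneg hp hp3),
    ENNReal.toReal_pow] at h2
  refine le_trans (le_of_eq ?_) h2
  congr 1
  refine lintegral_congr fun x => ?_
  rw [ENNReal.ofReal_pow (norm_nonneg _), ofReal_norm]

theorem periodic_add_smul {f h : ℝ → EuclideanSpace ℝ (Fin n)} (hf : Function.Periodic f 1)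
    (hh : Function.Periodic h 1) (τ : ℝ) : Function.Periodic (f + τ • h) 1 := by
  intro u
  simp [hf u, hh u]

variable {p : ℝ} {γ h g : ℝ → EuclideanSpace ℝ (Fin n)}
  {K : Set (Fin 6 → EuclideanSpace ℝ (Fin n))} {m m' : ℝ}

/-- The form is nonnegative on the diagonal, so integrability for small `τ` yields both the
finiteness of the energy and its equality with the Bochner integral. The compact set is left
arbitrary so that the statement can be reused at `γ + τ g`. -/
theorem hasFirstVariation_menger (hp : p ≠ 2) (hγ : ContDiff ℝ 1 γ)
    (hγper : Function.Periodic γ 1) (hh : ContDiff ℝ 1 h) (hhper : Function.Periodic h 1)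
    (hK : IsCompact K) (hKU : K ⊆ regularSet n) (hjet : ∀ᵐ x ∂mengerMeasure p, jet γ x ∈ K)
    (hγ2 : MemLp (defect γ) 2 (mengerMeasure p)) (hh2 : MemLp (defect h) 2 (mengerMeasure p))
    (hm : ∀ u, ‖deriv h u‖ ≤ m) :
    HasFirstVariation (menger p 2) γ h (∫ x, quadDeriv (mengerForm p) (jet γ x) (defect γ x)
      (jet h x) (defect h x) ∂mengerMeasure p) := by
  obtain ⟨h1, h2⟩ := hasDerivAt_integral_quad isOpen_regularSet (contDiffOn_mengerForm p) hK hKU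
    (measurable_jet hγ).aemeasurable hjet hγ2 (measurable_jet hh).aemeasurable
    (Eventually.of_forall (norm_jet_le hm)) hh2
  have key : ∀ τ : ℝ, menger p 2 (γ + τ • h) = ∫⁻ x, ENNReal.ofReal
      (mengerForm p (jet γ x + τ • jet h x) (defect γ x + τ • defect h x)
        (defect γ x + τ • defect h x)) ∂mengerMeasure p := by
    intro τ
    have hτ : ContDiff ℝ 1 (γ + τ • h) := hγ.add (hh.const_smul τ)
    rw [menger_eq_lintegral hp hτ (periodic_add_smul hγper hhper τ)]
    simp_rw [jet_add_smul hγ hh, defect_add_smul hγ hh]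
  constructor
  · filter_upwards [h1] with τ hτ
    rw [key τ]
    exact hτ.lintegral_lt_top.ne
  · refine h2.congr_of_eventuallyEq ?_
    filter_upwards [h1] with τ hτ
    rw [key τ, integral_eq_lintegral_of_nonneg_ae
      (Eventually.of_forall fun x => mengerForm_self_nonneg _ _ _) hτ.aestronglyMeasurable]

theorem hasSecondVariation_menger (hp : p ≠ 2) (hγ : ContDiff ℝ 1 γ)
    (hγper : Function.Periodic γ 1) (hh : ContDiff ℝ 1 h) (hhper : Function.Periodic h 1)
    (hg : ContDiff ℝ 1 g) (hgper : Function.Periodic g 1)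
    (hK : IsCompact K) (hKU : K ⊆ regularSet n) (hjet : ∀ᵐ x ∂mengerMeasure p, jet γ x ∈ K)
    (hγ2 : MemLp (defect γ) 2 (mengerMeasure p)) (hh2 : MemLp (defect h) 2 (mengerMeasure p))
    (hg2 : MemLp (defect g) 2 (mengerMeasure p)) (hm : ∀ u, ‖deriv h u‖ ≤ m)
    (hm' : ∀ u, ‖deriv g u‖ ≤ m') :
    HasSecondVariation (menger p 2) γ h g (∫ x, quadDeriv₂ (mengerForm p) (jet γ x) (defect γ x)
      (jet h x) (defect h x) (jet g x) (defect g x) ∂mengerMeasure p) := by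
  refine ⟨fun τ => ∫ x, quadDeriv (mengerForm p) (jet γ x + τ • jet g x)
    (defect γ x + τ • defect g x) (jet h x) (defect h x) ∂mengerMeasure p, ?_,
    hasDerivAt_integral_quadDeriv isOpen_regularSet (contDiffOn_mengerForm p) hK hKU
      (measurable_jet hγ).aemeasurable hjet hγ2 (measurable_jet hh).aemeasurable
      (Eventually.of_forall (norm_jet_le hm)) hh2 (measurable_jet hg).aemeasurable
      (Eventually.of_forall (norm_jet_le hm')) hg2⟩
  -- The jets of `γ + τ g` leave `K`, but for small `τ` they remain in a larger compact subset of
  -- the regular set, where the first variation is available.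
  obtain ⟨K', hK', hK'U, hev⟩ := exists_isCompact_eventually_mem isOpen_regularSet hK hKU m'
  filter_upwards [hev] with τ hτ
  have := hasFirstVariation_menger (γ := γ + τ • g) (m := m) hp (hγ.add (hg.const_smul τ))
    (periodic_add_smul hγper hgper τ) hh hhper hK' hK'U ?_ ?_ hh2 hm
  · simpa only [jet_add_smul hγ hg, defect_add_smul hγ hg] using this
  · filter_upwards [hjet] with x hx
    rw [jet_add_smul hγ hg]
    exact hτ _ _ hx (norm_jet_le hm' x)
  · have e : defect (γ + τ • g) = defect γ + τ • defect g :=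
      funext fun x => defect_add_smul hγ hg τ x
    rw [e]
    exact hγ2.add (hg2.const_smul τ)

/-- The bound of the integrand of the energy and its derivatives for curves of bilipschitz constant
at least `b` and seminorm at most `a`. -/
noncomputable def formConst (n : ℕ) (p b a : ℝ) : ℝ :=
  c2Sup (mengerForm (n := n) p)
    (annulus (EuclideanSpace ℝ (Fin n)) b (morreyConst (3 / 2 * p - 3) * a))

theorem exists_C2Bound_annulus (n : ℕ) (p : ℝ) {b : ℝ} (hb : 0 < b) (M : ℝ) :
    ∃ c, C2Bound (mengerForm (n := n) p) (annulus (EuclideanSpace ℝ (Fin n)) b M) c :=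
  exists_C2Bound isOpen_regularSet (contDiffOn_mengerForm p) (isCompact_annulus b M)
    (annulus_subset_regularSet hb)

theorem C2Bound_formConst (n : ℕ) (p : ℝ) {b : ℝ} (hb : 0 < b) (a : ℝ) :
    C2Bound (mengerForm (n := n) p) (annulus (EuclideanSpace ℝ (Fin n)) b
      (morreyConst (3 / 2 * p - 3) * a)) (formConst n p b a) := by
  obtain ⟨c, hc⟩ := exists_C2Bound_annulus n p hb (morreyConst (3 / 2 * p - 3) * a)
  exact hc.c2Sup

theorem formConst_nonneg (n : ℕ) (p : ℝ) {b : ℝ} (hb : 0 < b) (a : ℝ) :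
    0 ≤ formConst n p b a := by
  obtain ⟨c, hc⟩ := exists_C2Bound_annulus n p hb (morreyConst (3 / 2 * p - 3) * a)
  exact hc.c2Sup_nonneg

theorem formConst_mono (n : ℕ) {p : ℝ} (hp : 7 / 3 < p) {b b' a a' : ℝ} (hb' : 0 < b')
    (hb : b' ≤ b) (ha : a ≤ a') : formConst n p b a ≤ formConst n p b' a' := by
  obtain ⟨c, hc⟩ := exists_C2Bound_annulus n p hb' (morreyConst (3 / 2 * p - 3) * a')
  exact hc.c2Sup_mono (annulus_mono hb
    (mul_le_mul_of_nonneg_left ha (morreyConst_nonneg (by linarith))))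

/-- Only `formConst` depends on `b`; the polynomial factor `P` will collect the sup and `L²` bounds
of the curve and the directions. -/
theorem isMonotoneConstant_formConst_mul (n : ℕ) {p : ℝ} (hp : 7 / 3 < p) {P : ℝ → ℝ}
    (hP : ∀ a, 0 ≤ a → 0 ≤ P a) (hPmono : MonotoneOn P (Ici 0)) :
    IsMonotoneConstant fun b a => formConst n p b a * P a := by
  constructor
  · intro a ha b hb b' hb' hbb'
    exact mul_le_mul_of_nonneg_right (formConst_mono n hp hb hbb' le_rfl) (hP a ha)
  · intro b hb a ha a' ha' haa'
    exact mul_le_mul (formConst_mono n hp hb le_rfl haa') (hPmono ha ha' haa') (hP a ha)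
      (formConst_nonneg n p hb a')

end Variation

end Menger

/-! ### The theorem. -/

theorem theorem2p1 (n : ℕ) (p : ℝ) (hp : 7 / 3 < p) (hp' : p < 8 / 3) :
    ∃ C₁ C₂ : ℝ → ℝ → ℝ, Menger.IsMonotoneConstant C₁ ∧ Menger.IsMonotoneConstant C₂ ∧
      ∀ γ : ℝ → EuclideanSpace ℝ (Fin n), Menger.MemWir (3 / 2 * p - 3) γ →
        (∀ h : ℝ → EuclideanSpace ℝ (Fin n), Menger.MemW (3 / 2 * p - 3) h →
          ∃ d : ℝ, Menger.HasFirstVariation (Menger.menger p 2) γ h d ∧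
            |d| ≤ C₁ (Menger.biLip γ) (Menger.slobodeckijReal (3 / 2 * p - 3) (deriv γ)) *
              Menger.slobodeckijReal (3 / 2 * p - 3) (deriv h)) ∧
        (∀ h g : ℝ → EuclideanSpace ℝ (Fin n),
          Menger.MemW (3 / 2 * p - 3) h → Menger.MemW (3 / 2 * p - 3) g →
          ∃ d : ℝ, Menger.HasSecondVariation (Menger.menger p 2) γ h g d ∧
            |d| ≤ C₂ (Menger.biLip γ) (Menger.slobodeckijReal (3 / 2 * p - 3) (deriv γ)) *
              Menger.slobodeckijReal (3 / 2 * p - 3) (deriv h) *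
              Menger.slobodeckijReal (3 / 2 * p - 3) (deriv g)) := by
  have hs : 1 / 2 < 3 / 2 * p - 3 := by linarith
  have hp2 : 2 < p := by linarith
  have hp3 : p < 3 := by linarith
  set s : ℝ := 3 / 2 * p - 3 with hsdef
  set m : ℝ := Menger.morreyConst s with hmdef
  set D : ℝ := √(Menger.defectConst p) with hDdef
  have hm0 : 0 ≤ m := Menger.morreyConst_nonneg hs
  have hD0 : 0 ≤ D := Real.sqrt_nonneg _
  -- The integral bounds are applied with sup bounds `m [h']`, `m [g']` and `L²` bounds `D a`, `D
  -- [h']`, `D [g']`. The factor `[h']`, respectively `[h'] [g']`, then comes out of every term, and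
  -- what remains is this polynomial in `a`.
  refine ⟨fun b a => Menger.formConst n p b a * (D ^ 2 * (m * a ^ 2 + 2 * a)),
    fun b a => Menger.formConst n p b a * (D ^ 2 * (m ^ 2 * a ^ 2 + 4 * m * a + 2)), ?_, ?_, ?_⟩
  · refine Menger.isMonotoneConstant_formConst_mul n hp (fun a ha => by positivity) ?_
    intro a ha a' _ haa'
    have : 0 ≤ a := ha
    dsimp only
    gcongr
  · refine Menger.isMonotoneConstant_formConst_mul n hp (fun a ha => by positivity) ?_
    intro a ha a' _ haa'
    have : 0 ≤ a := ha
    dsimp only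
    gcongr
  rintro γ ⟨hγW, hinj, hreg⟩
  obtain ⟨hγ, hγfin, hγb⟩ := hγW.contDiff_and_bound hs
  have hb : 0 < Menger.biLip γ := Menger.biLip_pos hγ hγW.1 hinj hreg
  have hjet := Menger.jet_mem_annulus hp2 hγ hγb
  have hKc := Menger.isCompact_annulus (E := EuclideanSpace ℝ (Fin n)) (Menger.biLip γ)
    (m * Menger.slobodeckijReal s (deriv γ))
  have hKU := Menger.annulus_subset_regularSet (n := n)
    (M := m * Menger.slobodeckijReal s (deriv γ)) hb
  have hc := Menger.C2Bound_formConst n p hb (Menger.slobodeckijReal s (deriv γ))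
  have hc0 := Menger.formConst_nonneg n p hb (Menger.slobodeckijReal s (deriv γ))
  have hγ2 := Menger.memLp_defect hp2 hp3 hγ hγfin
  have hγN := Menger.integral_defect_sq_le hp2 hp3 hγ hγfin
  have hS : ∀ f : ℝ → EuclideanSpace ℝ (Fin n), 0 ≤ Menger.slobodeckijReal s (deriv f) :=
    fun f => ENNReal.toReal_nonneg
  constructor
  · intro h hW
    obtain ⟨hh, hfin, hbd⟩ := hW.contDiff_and_bound hs
    have hh2 := Menger.memLp_defect hp2 hp3 hh hfin
    refine ⟨_, Menger.hasFirstVariation_menger hp2.ne' hγ hγW.1 hh hW.1 hKc hKU hjet hγ2 hh2 hbd,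
      ?_⟩
    refine (Menger.abs_integral_quadDeriv_le hc hc0 (mul_nonneg hm0 (hS h)) hjet hγ2
      (Eventually.of_forall (Menger.norm_jet_le hbd)) hh2 (mul_nonneg hD0 (hS γ))
      (mul_nonneg hD0 (hS h)) hγN (Menger.integral_defect_sq_le hp2 hp3 hh hfin)).trans
      (le_of_eq ?_)
    ring
  · intro h g hW hgW
    obtain ⟨hh, hfin, hbd⟩ := hW.contDiff_and_bound hs
    obtain ⟨hg, hgfin, hgbd⟩ := hgW.contDiff_and_bound hs
    have hh2 := Menger.memLp_defect hp2 hp3 hh hfin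
    have hg2 := Menger.memLp_defect hp2 hp3 hg hgfin
    refine ⟨_, Menger.hasSecondVariation_menger hp2.ne' hγ hγW.1 hh hW.1 hg hgW.1 hKc hKU hjet
      hγ2 hh2 hg2 hbd hgbd, ?_⟩
    refine (Menger.abs_integral_quadDeriv₂_le hc hc0 (mul_nonneg hm0 (hS h))
      (mul_nonneg hm0 (hS g)) hjet hγ2 (Eventually.of_forall (Menger.norm_jet_le hbd)) hh2
      (Eventually.of_forall (Menger.norm_jet_le hgbd)) hg2 (mul_nonneg hD0 (hS γ))
      (mul_nonneg hD0 (hS h)) (mul_nonneg hD0 (hS g)) hγN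
      (Menger.integral_defect_sq_le hp2 hp3 hh hfin)
      (Menger.integral_defect_sq_le hp2 hp3 hg hgfin)).trans (le_of_eq ?_)
    ring
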